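/- Let $\Gamma=(\mathbb V,\mathbb E)$ be a connected, locally finite graph (finite or infinite) without double edges, with edge weights $\mu_{xy}=\mu_{yx}\ge 0$ such that $\mu_{xy}>0$ if and only if $(x,y)\in\mathbb E$, and let $\nu_x>0$ for $x\in\mathbb V$. Put $\mu_x=\sum_y\mu_{xy}$. Let $X=(X_t)_{t\ge0}$ be the continuous-time random walk on $\Gamma$ with generator $$\mathscr L f(x)=\frac1{\nu_x}\sum_{y}(f(y)-f(x))\mu_{xy},$$ that is, the process which waits at each vertex $x$ an exponential time of rate $\mu_x/\nu_x$, then jumps to $y$ with probability $\mu_{xy}/\mu_x$ (if $\mu_x=0$, it stays at $x$ forever), and is killed at its explosion time if it explodes. Let $\mathbb P_x$ be its law when started at $x$. Let $d_\nu$ be an adapted metric, that is, a metric on $\mathbb V$ with $$\frac1{\nu_x}\sum_y d_\nu(x,y)^2\mu_{xy}\le 1\ \text{ for all }x,\qquad d_\nu(x,y)\le 1\ \text{ whenever }(x,y)\in\mathbb E.$$ For $A\ge1$ and $\gamma>1$, a function $f:(0,\infty)\to(0,\infty)$ is called $(A,\gamma)$-regular if it is non-decreasing and $$\frac{f(\gamma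 s)}{f(s)}\le A\,\frac{f(\gamma t)}{f(t)}\qquad\text{for all }0<s<t.$$ **Theorem.** There are absolute constants $C_1,\theta>0$ such that the following holds for all $\Gamma,\mu,\nu,d_\nu$ as above, all $x_1,x_2\in\mathbb V$, and all $A\ge1$, $\gamma>1$, $\delta\ge1$. Suppose that $f_1,f_2$ are $(A,\gamma)$-regular and that, for $i=1,2$ and all $t>0$, $$\mathbb P_{x_i}(X_t=x_i)\le\frac1{f_i(t)},\qquad f_i(t)\le A e^{\delta t}.$$ Then for all $t>0$ with $t\ge d_\nu(x_1,x_2)$, $$\mathbb P_{x_1}(X_t=x_2)\le\frac{C_1A^{\beta}(\nu_{x_2}/\nu_{x_1})^{1/2}}{\sqrt{f_1(\alpha t)f_2(\alpha t)}}\exp\Bigl(-\theta\,\frac{d_\nu(x_1,x_2)^2}{t}\Bigr),$$ where $\alpha=\min\{(2\gamma)^{-1},(64\delta)^{-1}\}$ and $\beta=\lceil \log 2/\log\gamma\rceil$. -/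

import Mathlib

open MeasureTheory ProbabilityTheory

universe u v

/-- A connected, locally finite weighted graph on `V`, together with a positive vertex measure `ν`.
The weight `μ x y` is positive exactly when `(x, y)` is an edge, so the edge set is encoded by `μ`.
Self-loops are permitted; they play no role for the generator. -/
structure WeightedGraph (V : Type u) where
  /-- edge weights -/
  μ : V → V → ℝ
  /-- vertex weights -/
  ν : V → ℝ
  μ_nonneg : ∀ x y, 0 ≤ μ x y
  μ_symm : ∀ x y, μ x y = μ y x
  ν_pos : ∀ x, 0 < ν x
  locally_finite : ∀ x, {y | 0 < μ x y}.Finite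
  connected : (SimpleGraph.fromRel fun x y => 0 < μ x y).Connected

namespace WeightedGraph

variable {V : Type u} (Γ : WeightedGraph V)

/-- `μ_x = ∑_y μ_{xy}`, a sum with finitely many nonzero terms. -/
noncomputable def totalWeight (x : V) : ℝ := ∑ᶠ y, Γ.μ x y

/-- The rate `μ_x / ν_x` at which the walk leaves `x`. -/
noncomputable def rate (x : V) : ℝ := Γ.totalWeight x / Γ.ν x

open Classical in
/-- The transition matrix of the jump chain: `μ_{xy} / μ_x`.
(If `μ_x = 0`, which forces `V = {x}`, the chain stays at `x`.) -/
noncomputable def jumpProb (x y : V) : ℝ :=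
  if Γ.totalWeight x = 0 then (if x = y then 1 else 0) else Γ.μ x y / Γ.totalWeight x

/-- The metric `dist` on `V` is adapted to the weighted graph. -/
structure IsAdapted [MetricSpace V] : Prop where
  sum_le : ∀ x, 1 / Γ.ν x * ∑ᶠ y, dist x y ^ 2 * Γ.μ x y ≤ 1
  edge_le : ∀ x y, 0 < Γ.μ x y → dist x y ≤ 1

end WeightedGraph

/-- The continuous-time random walk on `Γ` with generator
`L f (x) = (1 / ν_x) ∑_y (f y - f x) μ_{xy}`, realized on a measurable space `Ω` by its jump chain
and its holding times. Under `P x`, the sequence `Y` is a discrete-time Markov chain started at `x`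
with transition matrix `μ_{xy} / μ_x`, and `E 0, E 1, …` are i.i.d. standard exponential variables
independent of `Y`; the `k`-th holding time is `E k / q (Y k)`, where `q x = μ_x / ν_x`. -/
structure RandomWalk {V : Type u} [MeasurableSpace V] (Γ : WeightedGraph V)
    (Ω : Type v) [MeasurableSpace Ω] where
  /-- the law of the walk started at a given vertex -/
  P : V → Measure Ω
  /-- the vertices visited successively -/
  Y : ℕ → Ω → V
  /-- the normalized holding times -/
  E : ℕ → Ω → ℝ
  isProbabilityMeasure : ∀ x, IsProbabilityMeasure (P x)
  measurable_Y : ∀ k, Measurable (Y k)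
  measurable_E : ∀ k, Measurable (E k)
  law_Y : ∀ x, ∀ n : ℕ, ∀ y : ℕ → V, y 0 = x →
    P x {ω | ∀ k ≤ n, Y k ω = y k} =
      ENNReal.ofReal (∏ k ∈ Finset.range n, Γ.jumpProb (y k) (y (k + 1)))
  law_E : ∀ x k, (P x).map (E k) = expMeasure 1
  indep_E : ∀ x, iIndepFun E (P x)
  indep_Y_E : ∀ x, IndepFun (fun ω k => Y k ω) (fun ω k => E k ω) (P x)

namespace RandomWalk

variable {V : Type u} [MeasurableSpace V] {Γ : WeightedGraph V} {Ω : Type v} [MeasurableSpace Ω]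
  (W : RandomWalk Γ Ω)

/-- The time of the `n`-th jump (`∞` if that jump never happens). -/
noncomputable def jumpTime (n : ℕ) (ω : Ω) : ENNReal :=
  ∑ k ∈ Finset.range n, ENNReal.ofReal (W.E k ω) / ENNReal.ofReal (Γ.rate (W.Y k ω))

open Classical in
/-- The position of the walk at time `t`: the vertex `Y n` for the unique `n` with
`jumpTime n ≤ t < jumpTime (n + 1)`, and the cemetery state `none` once the walk has exploded. -/
noncomputable def X (t : ℝ) (ω : Ω) : Option V :=
  if h : ∃ n, W.jumpTime n ω ≤ ENNReal.ofReal t ∧ ENNReal.ofReal t < W.jumpTime (n + 1) ω then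
    some (W.Y h.choose ω)
  else none

end RandomWalk

/-- `f` is `(A, γ)`-regular: positive and non-decreasing, with
`f (γ s) / f s ≤ A * (f (γ t) / f t)` for `s < t`. Only the values on `(0, ∞)` matter. -/
structure HasRegularGrowth (A γ : ℝ) (f : ℝ → ℝ) : Prop where
  pos : ∀ t, 0 < t → 0 < f t
  mono : MonotoneOn f (Set.Ioi 0)
  ratio_le : ∀ s t, 0 < s → s < t → f (γ * s) / f s ≤ A * (f (γ * t) / f t)

/-! All estimates are made for the walk killed outside a finite set `B`, with constants independent
of `B`. Its kernel, conjugated by `√ν`, is the exponential of a symmetric matrix, so a diagonal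
entry at time 2s is the squared ℓ² norm of the kernel at time s. Killing only lowers return
probabilities, so the on-diagonal hypotheses pass to the killed kernel.

Split the kernel at time t/2 and let D = d(x₁, x₂). Every vertex is at distance at least D/2 from x₁
or from x₂, so by Cauchy–Schwarz it suffices to bound the ℓ² mass of each kernel beyond D/2
(`killedKernel_le_tailMass`). Such masses are controlled by the integral maximum principle
(`IsAdapted.weighted_energy_le`); adaptedness lets a weight exp ξ act as on a manifold, provided ξ
varies boundedly along edges. A Gaussian weight compares the mass beyond R at time τ with the mass
beyond r < R at an earlier time, up to an on-diagonal value times exp(-(R-r)²/(12τ))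
(`IsAdapted.tailMass_step`). This is iterated with geometrically decreasing times and radii staying
above R/2. Regular growth lets the on-diagonal values grow only like L^k, and the Gaussian gains
beat this.

Unlike on a manifold, the iteration cannot run down to time 0: once the space increment exceeds the
time scale, the weight is too steep. There a linear weight gives exponential decay
(`IsAdapted.tailMass_le_exp`), and the a priori bound f ≤ A exp(δt) makes this decay sufficient
(`stop_exponent_le`).

The walk itself is reached by expanding over finite paths. The killed transition function sums the
paths inside `B`, and the walk's transition function sums all paths, whether or not the walk
explodes; hence both the domination and the passage to the limit. -/

namespace WeightedGraph

/-! ### Edge sums and the symmetrized killed semigroup -/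

variable {V : Type u} (Γ : WeightedGraph V)

theorem finite_support_μ (x : V) : (Function.support (Γ.μ x)).Finite :=
  (Γ.locally_finite x).subset fun y hy => lt_of_le_of_ne (Γ.μ_nonneg x y) (Ne.symm hy)

theorem sum_μ_le_totalWeight (x : V) (B : Finset V) : ∑ y ∈ B, Γ.μ x y ≤ Γ.totalWeight x := by
  classical
  unfold totalWeight
  rw [finsum_eq_sum_of_support_subset (s := B ∪ (Γ.finite_support_μ x).toFinset) _
    (fun y hy => by simp; right; exact hy)]
  exact Finset.sum_le_sum_of_subset_of_nonneg Finset.subset_union_left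
    fun _ _ _ => Γ.μ_nonneg _ _

theorem totalWeight_nonneg (x : V) : 0 ≤ Γ.totalWeight x :=
  finsum_nonneg fun _ => Γ.μ_nonneg _ _

theorem rate_nonneg (x : V) : 0 ≤ Γ.rate x :=
  div_nonneg (Γ.totalWeight_nonneg x) (Γ.ν_pos x).le

theorem μ_eq_zero_of_totalWeight_eq_zero {x : V} (h : Γ.totalWeight x = 0) (y : V) :
    Γ.μ x y = 0 := by
  have := Γ.sum_μ_le_totalWeight x {y}
  rw [h, Finset.sum_singleton] at this
  exact le_antisymm this (Γ.μ_nonneg _ _)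

variable {Γ} in
theorem IsAdapted.sum_dist_sq_le [MetricSpace V] (h : Γ.IsAdapted) (x : V) (B : Finset V) :
    ∑ y ∈ B, dist x y ^ 2 * Γ.μ x y ≤ Γ.ν x := by
  classical
  have h1 := h.sum_le x
  rw [finsum_eq_sum_of_support_subset (s := B ∪ (Γ.finite_support_μ x).toFinset) _
    (fun y hy => by simp; right; exact right_ne_zero_of_mul hy)] at h1
  rw [one_div, inv_mul_le_iff₀ (Γ.ν_pos x), mul_one] at h1
  exact (Finset.sum_le_sum_of_subset_of_nonneg Finset.subset_union_left
    fun _ _ _ => mul_nonneg (sq_nonneg _) (Γ.μ_nonneg _ _)).trans h1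

open Classical in
/-- The generator of the walk killed outside `B`, symmetrized by conjugation with `√ν`. -/
noncomputable def symmGenerator (B : Finset V) : Matrix B B ℝ :=
  fun x y => Γ.μ x y / (√(Γ.ν x) * √(Γ.ν y)) - if x = y then Γ.rate x else 0

open Classical in
/-- The semigroup generated by `symmGenerator`. -/
noncomputable def killedKernel (B : Finset V) (t : ℝ) : Matrix B B ℝ :=
  NormedSpace.exp (t • Γ.symmGenerator B)

theorem symmGenerator_isSymm (B : Finset V) : (Γ.symmGenerator B).IsSymm := by
  ext x y
  simp only [Matrix.transpose_apply, symmGenerator]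
  rw [Γ.μ_symm, mul_comm]
  congr 1
  by_cases h : x = y
  · simp [h]
  · simp [h, Ne.symm h]

theorem killedKernel_symm (B : Finset V) (t : ℝ) (x y : B) :
    Γ.killedKernel B t x y = Γ.killedKernel B t y x := by
  classical
  have := ((Γ.symmGenerator_isSymm B).smul t).exp
  exact this.apply y x

open Classical in
theorem killedKernel_zero (B : Finset V) : Γ.killedKernel B 0 = 1 := by
  simp [killedKernel]

open Classical in
theorem killedKernel_add (B : Finset V) (s t : ℝ) :
    Γ.killedKernel B (s + t) = Γ.killedKernel B s * Γ.killedKernel B t := by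
  unfold killedKernel
  rw [add_smul]
  exact Matrix.exp_add_of_commute _ _ (((Commute.refl _).smul_left _).smul_right _)

attribute [local instance] Matrix.linftyOpNormedRing Matrix.linftyOpNormedAlgebra in
theorem hasDerivAt_killedKernel (B : Finset V) (t : ℝ) (x y : B) :
    HasDerivAt (fun t => Γ.killedKernel B t x y)
      (∑ z, Γ.symmGenerator B x z * Γ.killedKernel B t z y) t := by
  classical
  have h := hasDerivAt_exp_smul_const' (𝕂 := ℝ) (Γ.symmGenerator B) t
  have h2 := (hasDerivAt_pi.1 ((hasDerivAt_pi.1 h) x)) y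
  exact h2

/-- Semigroup property and symmetry together; this is how on-diagonal bounds become ℓ² bounds. -/
theorem killedKernel_two_mul_diag (B : Finset V) (t : ℝ) (x : B) :
    Γ.killedKernel B (2 * t) x x = ∑ z, Γ.killedKernel B t z x ^ 2 := by
  rw [two_mul, killedKernel_add, Matrix.mul_apply]
  exact Finset.sum_congr rfl fun z _ => by rw [Γ.killedKernel_symm B t x z, sq]

end WeightedGraph

/-! ### The integral maximum principle -/

theorem Real.cosh_sub_one_le_sq {s : ℝ} (hs : |s| ≤ 1) : Real.cosh s - 1 ≤ s ^ 2 := by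
  have h1 := Real.cosh_le_exp_half_sq s
  have h2 : s ^ 2 ≤ 1 := (sq_le_one_iff_abs_le_one s).2 hs
  have h3 : |s ^ 2 / 2| ≤ 1 := by
    rw [abs_of_nonneg (by positivity)]; linarith
  have h4 := (abs_le.1 (Real.abs_exp_sub_one_le h3)).2
  rw [abs_of_nonneg (by positivity)] at h4
  linarith

namespace WeightedGraph

variable {V : Type u} (Γ : WeightedGraph V)

/-- The exponentially weighted form of the killed generator is bounded by its gradient term. -/
theorem sum_symmGenerator_weighted_le (B : Finset V) (u ξ : B → ℝ) :
    ∑ x, u x * Real.exp (ξ x) * ∑ y, Γ.symmGenerator B x y * u y ≤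
      ∑ x, u x ^ 2 * Real.exp (ξ x) *
        ((∑ y : B, Γ.μ x y * (Real.cosh ((ξ x - ξ y) / 2) - 1)) / Γ.ν x) := by
  classical
  -- Half of the weight is absorbed into each factor, which leaves exp((ξ x - ξ y)/2) on the edge;
  -- symmetry of `μ` then replaces it by cosh.
  set a : B → ℝ := fun x => u x * Real.exp (ξ x / 2) / √(Γ.ν x) with ha
  have hν : ∀ x : B, 0 < √(Γ.ν x) := fun x => Real.sqrt_pos.2 (Γ.ν_pos x)
  have hsq : ∀ x : B, a x ^ 2 = u x ^ 2 * Real.exp (ξ x) / Γ.ν x := by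
    intro x
    rw [ha]
    simp only
    rw [div_pow, Real.sq_sqrt (Γ.ν_pos x).le, mul_pow, ← Real.exp_nat_mul]
    congr 3; push_cast; ring_nf
  have hL : ∑ x, u x * Real.exp (ξ x) * ∑ y, Γ.symmGenerator B x y * u y =
      ∑ x : B, ∑ y : B, Γ.μ x y * (a x * a y * Real.exp ((ξ x - ξ y) / 2)) -
        ∑ x, a x ^ 2 * Γ.totalWeight x := by
    rw [← Finset.sum_sub_distrib]
    refine Finset.sum_congr rfl fun x _ => ?_
    have : ∑ y, Γ.symmGenerator B x y * u y =
        ∑ y : B, Γ.μ x y / (√(Γ.ν x) * √(Γ.ν y)) * u y - Γ.rate x * u x := by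
      simp [symmGenerator, sub_mul, Finset.sum_sub_distrib, ite_mul]
    rw [this, mul_sub, Finset.mul_sum, hsq]
    congr 1
    · refine Finset.sum_congr rfl fun y _ => ?_
      have e : Real.exp (ξ x) = Real.exp (ξ x / 2) * Real.exp (ξ y / 2) *
          Real.exp ((ξ x - ξ y) / 2) := by
        rw [← Real.exp_add, ← Real.exp_add]; ring_nf
      rw [e, ha]
      have := (hν x).ne'
      have := (hν y).ne'
      field_simp
    · unfold rate
      ring
  have hsymm : ∑ x : B, ∑ y : B, Γ.μ x y * (a x * a y * Real.exp ((ξ x - ξ y) / 2)) =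
      ∑ x : B, ∑ y : B, Γ.μ x y * (a x * a y * Real.cosh ((ξ x - ξ y) / 2)) := by
    have hsw : ∑ x : B, ∑ y : B, Γ.μ x y * (a x * a y * Real.exp ((ξ x - ξ y) / 2)) =
        ∑ x : B, ∑ y : B, Γ.μ x y * (a x * a y * Real.exp (-((ξ x - ξ y) / 2))) := by
      rw [Finset.sum_comm]
      refine Finset.sum_congr rfl fun x _ => Finset.sum_congr rfl fun y _ => ?_
      rw [Γ.μ_symm]
      ring_nf
    have : ∑ x : B, ∑ y : B, Γ.μ x y * (a x * a y * Real.cosh ((ξ x - ξ y) / 2)) =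
        (∑ x : B, ∑ y : B, Γ.μ x y * (a x * a y * Real.exp ((ξ x - ξ y) / 2)) +
        ∑ x : B, ∑ y : B, Γ.μ x y * (a x * a y * Real.exp (-((ξ x - ξ y) / 2)))) / 2 := by
      rw [← Finset.sum_add_distrib, Finset.sum_div]
      refine Finset.sum_congr rfl fun x _ => ?_
      rw [← Finset.sum_add_distrib, Finset.sum_div]
      refine Finset.sum_congr rfl fun y _ => ?_
      rw [Real.cosh_eq]; ring
    rw [this, ← hsw]; ring
  have hbd : ∑ x : B, ∑ y : B, Γ.μ x y * (a x * a y * Real.cosh ((ξ x - ξ y) / 2)) ≤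
      ∑ x : B, ∑ y : B, Γ.μ x y * (a x ^ 2 * Real.cosh ((ξ x - ξ y) / 2)) := by
    have hsw : ∑ x : B, ∑ y : B, Γ.μ x y * (a x ^ 2 * Real.cosh ((ξ x - ξ y) / 2)) =
        ∑ x : B, ∑ y : B, Γ.μ x y * (a y ^ 2 * Real.cosh ((ξ x - ξ y) / 2)) := by
      rw [Finset.sum_comm]
      refine Finset.sum_congr rfl fun x _ => Finset.sum_congr rfl fun y _ => ?_
      rw [Γ.μ_symm, ← Real.cosh_neg]
      ring_nf
    have : ∑ x : B, ∑ y : B, Γ.μ x y * (a x ^ 2 * Real.cosh ((ξ x - ξ y) / 2)) =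
        ∑ x : B, ∑ y : B, Γ.μ x y * ((a x ^ 2 + a y ^ 2) / 2 * Real.cosh ((ξ x - ξ y) / 2)) := by
      have h2 : ∑ x : B, ∑ y : B,
          Γ.μ x y * ((a x ^ 2 + a y ^ 2) / 2 * Real.cosh ((ξ x - ξ y) / 2)) =
          (∑ x : B, ∑ y : B, Γ.μ x y * (a x ^ 2 * Real.cosh ((ξ x - ξ y) / 2)) +
          ∑ x : B, ∑ y : B, Γ.μ x y * (a y ^ 2 * Real.cosh ((ξ x - ξ y) / 2))) / 2 := by
        rw [← Finset.sum_add_distrib, Finset.sum_div]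
        refine Finset.sum_congr rfl fun x _ => ?_
        rw [← Finset.sum_add_distrib, Finset.sum_div]
        refine Finset.sum_congr rfl fun y _ => ?_
        ring
      rw [h2, ← hsw]; ring
    rw [this]
    refine Finset.sum_le_sum fun x _ => Finset.sum_le_sum fun y _ => ?_
    refine mul_le_mul_of_nonneg_left (mul_le_mul_of_nonneg_right ?_ (Real.cosh_pos _).le)
      (Γ.μ_nonneg _ _)
    nlinarith [sq_nonneg (a x - a y)]
  rw [hL, hsymm]
  refine (sub_le_sub_right hbd _).trans ?_
  rw [← Finset.sum_sub_distrib]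
  refine Finset.sum_le_sum fun x _ => ?_
  -- Weight leading out of `B` is lost to killing and has the favourable sign.
  have hW : ∑ y : B, Γ.μ x y ≤ Γ.totalWeight x := by
    have := Γ.sum_μ_le_totalWeight x B
    rwa [← Finset.sum_coe_sort] at this
  have hR : u x ^ 2 * Real.exp (ξ x) *
        ((∑ y : B, Γ.μ x y * (Real.cosh ((ξ x - ξ y) / 2) - 1)) / Γ.ν x) =
      ∑ y : B, Γ.μ x y * (a x ^ 2 * Real.cosh ((ξ x - ξ y) / 2)) - a x ^ 2 * ∑ y : B, Γ.μ x y := by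
    rw [hsq, Finset.mul_sum, ← Finset.sum_sub_distrib, mul_div_assoc', Finset.mul_sum,
      Finset.sum_div]
    refine Finset.sum_congr rfl fun y _ => ?_
    ring
  rw [hR]
  exact sub_le_sub_left (mul_le_mul_of_nonneg_left hW (sq_nonneg _)) _

-- Both halves of adaptedness enter here: edges of length at most 1 keep cosh in its quadratic
-- range, and the resulting ∑ d² μ is at most ν. Pairs at distance above 1 are not edges, so nothing
-- is asked of ξ there.
variable {Γ} in
theorem IsAdapted.sum_cosh_sub_one_le [MetricSpace V] (h : Γ.IsAdapted) (B : Finset V) (ξ : B → ℝ)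
    (x : B) (g : ℝ) (hg1 : g ≤ 1)
    (hξ : ∀ y : B, |ξ x - ξ y| ≤ 2 * g * dist (x : V) y ∨ 1 < dist (x : V) y) :
    (∑ y : B, Γ.μ x y * (Real.cosh ((ξ x - ξ y) / 2) - 1)) / Γ.ν x ≤ g ^ 2 := by
  rw [div_le_iff₀ (Γ.ν_pos _)]
  have h1 : ∑ y : B, dist (x : V) y ^ 2 * Γ.μ x y ≤ Γ.ν x := by
    have := h.sum_dist_sq_le (x : V) B
    rwa [← Finset.sum_coe_sort] at this
  refine le_trans ?_ (mul_le_mul_of_nonneg_left h1 (sq_nonneg g))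
  rw [Finset.mul_sum]
  refine Finset.sum_le_sum fun y _ => ?_
  rcases (Γ.μ_nonneg x y).eq_or_lt with h0 | h0
  · simp [← h0]
  have hd := h.edge_le _ _ h0
  have hy := (hξ y).resolve_right hd.not_gt
  have h2 : |(ξ x - ξ y) / 2| ≤ g * dist (x : V) y := by
    rw [abs_div, abs_two]; linarith
  have h3 : Real.cosh ((ξ x - ξ y) / 2) - 1 ≤ g ^ 2 * dist (x : V) y ^ 2 := by
    refine (Real.cosh_sub_one_le_sq (h2.trans (mul_le_one₀ hg1 dist_nonneg hd))).trans ?_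
    rw [← sq_abs, ← mul_pow]
    exact pow_le_pow_left₀ (abs_nonneg _) h2 2
  calc _ ≤ Γ.μ x y * (g ^ 2 * dist (x : V) y ^ 2) := mul_le_mul_of_nonneg_left h3 h0.le
    _ = _ := by ring

variable {Γ} in
/-- The integral maximum principle: if `ξ' + |∇ξ|² / 2 ≤ 0` in a suitable discrete sense, then the
`exp ξ`-weighted `ℓ²` norm of a solution of the killed heat equation is non-increasing. -/
theorem IsAdapted.weighted_energy_le [MetricSpace V] (h : Γ.IsAdapted) (B : Finset V)
    (u ξ ξ' g : ℝ → B → ℝ)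
    (hu : ∀ s x, HasDerivAt (fun s => u s x) (∑ y, Γ.symmGenerator B x y * u s y) s)
    {a b : ℝ} (hab : a ≤ b)
    (hξ : ∀ s ∈ Set.Icc a b, ∀ x, HasDerivAt (fun s => ξ s x) (ξ' s x) s)
    (hξ' : ∀ s ∈ Set.Icc a b, ∀ x, ξ' s x ≤ -(2 * g s x ^ 2))
    (hg1 : ∀ s ∈ Set.Icc a b, ∀ x, g s x ≤ 1)
    (hlip : ∀ s ∈ Set.Icc a b, ∀ x y : B,
      |ξ s x - ξ s y| ≤ 2 * g s x * dist (x : V) y ∨ 1 < dist (x : V) y) :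
    ∑ x, u b x ^ 2 * Real.exp (ξ b x) ≤ ∑ x, u a x ^ 2 * Real.exp (ξ a x) := by
  have hder : ∀ s ∈ Set.Icc a b, HasDerivAt (fun s => ∑ x, u s x ^ 2 * Real.exp (ξ s x))
      (2 * (∑ x, u s x * Real.exp (ξ s x) * ∑ y, Γ.symmGenerator B x y * u s y) +
        ∑ x, u s x ^ 2 * Real.exp (ξ s x) * ξ' s x) s := by
    intro s hs
    rw [Finset.mul_sum, ← Finset.sum_add_distrib]
    refine HasDerivAt.fun_sum fun x _ => ?_
    refine (((hu s x).fun_pow 2).mul ((hξ s hs x).exp)).congr_deriv ?_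
    simp only [Nat.cast_ofNat]
    ring
  have hanti : AntitoneOn (fun s => ∑ x, u s x ^ 2 * Real.exp (ξ s x)) (Set.Icc a b) := by
    refine antitoneOn_of_deriv_nonpos (convex_Icc a b)
      (fun s hs => (hder s hs).continuousAt.continuousWithinAt)
      (fun s hs => (hder s (interior_subset hs)).differentiableAt.differentiableWithinAt) ?_
    intro s hs
    have hs := interior_subset hs
    rw [(hder s hs).deriv]
    -- The energy form contributes at most 2g² against u² exp ξ, which the assumed decrease of ξ
    -- cancels.
    have h1 := Γ.sum_symmGenerator_weighted_le B (u s) (ξ s)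
    have h2 : ∑ x, u s x ^ 2 * Real.exp (ξ s x) *
        ((∑ y : B, Γ.μ x y * (Real.cosh ((ξ s x - ξ s y) / 2) - 1)) / Γ.ν x) ≤
        ∑ x, u s x ^ 2 * Real.exp (ξ s x) * g s x ^ 2 :=
      Finset.sum_le_sum fun x _ => mul_le_mul_of_nonneg_left
        (h.sum_cosh_sub_one_le B (ξ s) x (g s x) (hg1 s hs x) (hlip s hs x))
        (by positivity)
    have h3 : ∑ x, u s x ^ 2 * Real.exp (ξ s x) * ξ' s x ≤
        ∑ x, u s x ^ 2 * Real.exp (ξ s x) * (-(2 * g s x ^ 2)) :=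
      Finset.sum_le_sum fun x _ => mul_le_mul_of_nonneg_left (hξ' s hs x) (by positivity)
    have h4 : ∑ x, u s x ^ 2 * Real.exp (ξ s x) * (-(2 * g s x ^ 2)) =
        -(2 * ∑ x, u s x ^ 2 * Real.exp (ξ s x) * g s x ^ 2) := by
      rw [Finset.mul_sum, ← Finset.sum_neg_distrib]
      exact Finset.sum_congr rfl fun x _ => by ring
    linarith
  exact hanti (Set.left_mem_Icc.2 hab) (Set.right_mem_Icc.2 hab) hab

end WeightedGraph

/-! ### Mass of the kernel far from its pole -/

namespace WeightedGraph

variable {V : Type u} (Γ : WeightedGraph V)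

open Classical in
/-- The squared `ℓ²` mass of the killed kernel started at `o`, at distance at least `R` from `o`. -/
noncomputable def tailMass [MetricSpace V] (B : Finset V) (o : B) (R s : ℝ) : ℝ :=
  ∑ z : B, if R ≤ dist (o : V) z then Γ.killedKernel B s z o ^ 2 else 0

variable [MetricSpace V]

theorem tailMass_nonneg (B : Finset V) (o : B) (R s : ℝ) : 0 ≤ Γ.tailMass B o R s :=
  Finset.sum_nonneg fun z _ => by split_ifs <;> positivity

theorem tailMass_le_diag (B : Finset V) (o : B) (R s : ℝ) :
    Γ.tailMass B o R s ≤ Γ.killedKernel B (2 * s) o o := by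
  rw [killedKernel_two_mul_diag]
  refine Finset.sum_le_sum fun z _ => ?_
  split_ifs
  · exact le_rfl
  · positivity

variable {Γ}

/-- The weight exp(2 d(o, ·) - 2s) has g = 1, the steepest slope allowed. No on-diagonal bound is
used, so the estimate remains available at small times. -/
theorem IsAdapted.tailMass_le_exp (h : Γ.IsAdapted) (B : Finset V) (o : B) (R : ℝ) {s : ℝ}
    (hs : 0 ≤ s) : Γ.tailMass B o R s ≤ Real.exp (-(2 * R) + 2 * s) := by
  classical
  have key := h.weighted_energy_le B (fun s x => Γ.killedKernel B s x o)
    (fun s x => 2 * dist (o : V) x - 2 * s) (fun _ _ => -2) (fun _ _ => 1)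
    (fun s x => Γ.hasDerivAt_killedKernel B s x o) hs
    (fun s _ x => by
      simpa using ((hasDerivAt_id s).const_mul (2 : ℝ)).const_sub (2 * dist (o : V) x))
    (fun _ _ _ => by norm_num) (fun _ _ _ => le_rfl)
    (fun s _ x y => by
      left
      have := abs_dist_sub_le (x : V) y o
      rw [dist_comm (x : V) o, dist_comm (y : V) o] at this
      rw [show 2 * dist (o : V) x - 2 * s - (2 * dist (o : V) y - 2 * s) =
        2 * (dist (o : V) x - dist (o : V) y) by ring, abs_mul, abs_two]
      linarith)
  have h0 : ∑ x, Γ.killedKernel B 0 x o ^ 2 * Real.exp (2 * dist (o : V) x - 2 * 0) = 1 := by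
    rw [killedKernel_zero, Finset.sum_eq_single o]
    · simp
    · intro b _ hb
      simp [hb]
    · simp
  rw [h0] at key
  have : Γ.tailMass B o R s ≤ Real.exp (-(2 * R) + 2 * s) *
      ∑ x, Γ.killedKernel B s x o ^ 2 * Real.exp (2 * dist (o : V) x - 2 * s) := by
    rw [Finset.mul_sum]
    refine Finset.sum_le_sum fun z _ => ?_
    split_ifs with hz
    · rw [mul_left_comm, ← Real.exp_add]
      exact le_mul_of_one_le_right (sq_nonneg _) (Real.one_le_exp (by linarith))
    · positivity
  exact this.trans (mul_le_of_le_one_right (Real.exp_pos _).le key)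

/-- The weight exp(-ρ²/(6(2τ - s))) equals exp(-1/(6τ)) beyond R at time τ. At time τ' it is at most
1 everywhere and at most exp(-(R-r)²/(12τ)) within radius r. The singularity sits at 2τ so that the
weight stays regular up to s = τ. -/
theorem IsAdapted.tailMass_step (h : Γ.IsAdapted) (B : Finset V) (o : B) {R r τ τ' : ℝ}
    (hτ : 0 < τ) (hτ' : 0 ≤ τ') (hττ : τ' ≤ τ) (hr : r ≤ R) (h4 : max (R - r) 1 ≤ 4 * τ) :
    Γ.tailMass B o R τ ≤ Real.exp (1 / (6 * τ)) * (Γ.tailMass B o r τ' +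
      Real.exp (-((R - r) ^ 2 / (12 * τ))) * Γ.killedKernel B (2 * τ') o o) := by
  classical
  -- The floor 1 dominates edge lengths, so ρ² varies by at most 3 ρ(x) d(x, y) along an edge; its
  -- price is the factor exp(1/(6τ)). The cap at R - r yields ρ ≤ 4τ, which is what g ≤ 1 requires.
  set ρ : B → ℝ := fun z => max 1 (min (R - dist (o : V) z) (R - r)) with hρ
  have hρ1 : ∀ z, 1 ≤ ρ z := fun z => le_max_left _ _
  have hρ4 : ∀ z, ρ z ≤ 4 * τ := fun z =>
    (max_le (le_max_right _ _) ((min_le_right _ _).trans (le_max_left _ _))).trans h4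
  have hρlip : ∀ x y : B, |ρ x - ρ y| ≤ dist (x : V) y := by
    intro x y
    have h1 := abs_max_sub_max_le_abs (min (R - dist (o : V) x) (R - r))
      (min (R - dist (o : V) y) (R - r)) 1
    rw [max_comm _ 1, max_comm _ 1] at h1
    refine h1.trans ?_
    refine (abs_min_sub_min_le_max _ _ _ _).trans (max_le ?_ (by simp))
    have := abs_dist_sub_le (x : V) y o
    rw [dist_comm (x : V) o, dist_comm (y : V) o, abs_sub_comm] at this
    refine le_trans (le_of_eq ?_) this
    congr 1
    ring
  have hpos : ∀ s ∈ Set.Icc τ' τ, 0 < 2 * τ - s := fun s hs => by linarith [hs.2]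
  have key := h.weighted_energy_le B (fun s x => Γ.killedKernel B s x o)
    (fun s x => -(ρ x ^ 2 / 6) * (2 * τ - s)⁻¹)
    (fun s x => -(ρ x ^ 2 / 6) * ((2 * τ - s) ^ 2)⁻¹) (fun s x => ρ x / 4 * (2 * τ - s)⁻¹)
    (fun s x => Γ.hasDerivAt_killedKernel B s x o) hττ
    (fun s hs x => by
      have h1 := (((hasDerivAt_id s).const_sub (2 * τ)).fun_inv (hpos s hs).ne').const_mul
        (-(ρ x ^ 2 / 6))
      refine h1.congr_deriv ?_
      simp [div_eq_mul_inv])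
    (fun s hs x => by
      have := hpos s hs
      rw [mul_pow, inv_pow]
      have : 0 ≤ ((2 * τ - s) ^ 2)⁻¹ := by positivity
      nlinarith [mul_nonneg (sq_nonneg (ρ x)) this])
    (fun s hs x => by
      rw [← div_eq_mul_inv, div_le_one (hpos s hs)]
      linarith [hρ4 x, hs.2])
    (fun s hs x y => by
      rcases le_or_gt (dist (x : V) y) 1 with hd | hd
      · left
        have hp := inv_pos.2 (hpos s hs)
        have h1 : |ρ x ^ 2 - ρ y ^ 2| ≤ 3 * ρ x * dist (x : V) y := by
          rw [sq_sub_sq, abs_mul, mul_comm]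
          rw [mul_comm (3 * ρ x)]
          refine mul_le_mul (hρlip x y) ?_ (abs_nonneg _) dist_nonneg
          have := (abs_le.1 (hρlip x y)).1
          rw [abs_of_nonneg (by linarith [hρ1 x, hρ1 y])]
          linarith [hρ1 x]
        have h2 : -(ρ x ^ 2 / 6) * (2 * τ - s)⁻¹ - -(ρ y ^ 2 / 6) * (2 * τ - s)⁻¹ =
            -((ρ x ^ 2 - ρ y ^ 2) * ((2 * τ - s)⁻¹ / 6)) := by ring
        rw [h2, abs_neg, abs_mul, abs_of_pos (show 0 < (2 * τ - s)⁻¹ / 6 by positivity)]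
        calc _ ≤ 3 * ρ x * dist (x : V) y * ((2 * τ - s)⁻¹ / 6) := by gcongr
          _ = _ := by ring
      · right; exact hd)
  have hlow : Γ.tailMass B o R τ ≤ Real.exp (1 / (6 * τ)) *
      ∑ x, Γ.killedKernel B τ x o ^ 2 * Real.exp (-(ρ x ^ 2 / 6) * (2 * τ - τ)⁻¹) := by
    rw [Finset.mul_sum]
    refine Finset.sum_le_sum fun z _ => ?_
    split_ifs with hz
    · have : ρ z = 1 := max_eq_left ((min_le_left _ _).trans (by linarith))
      rw [mul_left_comm, ← Real.exp_add, this]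
      refine le_mul_of_one_le_right (sq_nonneg _) (Real.one_le_exp (le_of_eq ?_))
      rw [show 2 * τ - τ = τ by ring]
      field_simp
      ring
    · positivity
  refine hlow.trans (mul_le_mul_of_nonneg_left (key.trans ?_) (Real.exp_pos _).le)
  rw [killedKernel_two_mul_diag, Finset.mul_sum, tailMass, ← Finset.sum_add_distrib]
  refine Finset.sum_le_sum fun z _ => ?_
  have hp := hpos τ' ⟨le_rfl, hττ⟩
  split_ifs with hz
  · have : Real.exp (-(ρ z ^ 2 / 6) * (2 * τ - τ')⁻¹) ≤ 1 := by
      rw [Real.exp_le_one_iff, neg_mul, neg_nonpos]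
      positivity
    have h2 := mul_le_mul_of_nonneg_left this (sq_nonneg (Γ.killedKernel B τ' z o))
    have h3 : 0 ≤ Real.exp (-((R - r) ^ 2 / (12 * τ))) * Γ.killedKernel B τ' z o ^ 2 := by
      positivity
    linarith
  · push Not at hz
    have h1 : R - r ≤ ρ z := (le_min (by linarith) le_rfl).trans (le_max_right _ _)
    rw [zero_add, mul_comm]
    refine mul_le_mul_of_nonneg_right (Real.exp_le_exp.2 ?_) (sq_nonneg _)
    rw [neg_mul, neg_le_neg_iff, ← div_eq_mul_inv, div_div]
    have : R - r ≥ 0 := by linarith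
    rw [show 12 * τ = 6 * (2 * τ) by ring]
    gcongr
    linarith

end WeightedGraph

/-! ### Regular growth and the arithmetic of the scales -/

theorem HasRegularGrowth.le_pow_mul {A γ : ℝ} {f : ℝ → ℝ} (hf : HasRegularGrowth A γ f)
    (hA : 1 ≤ A) (hγ : 1 < γ) {t s : ℝ} (hs : 0 < s) (hst : s ≤ t) (k : ℕ) :
    f s ≤ (A * (f t / f (t / γ))) ^ k * f (s / γ ^ k) := by
  have hγ0 : 0 < γ := by linarith
  have ht : 0 < t := hs.trans_le hst
  -- Regularity bounds the growth ratio at every smaller scale by A times the ratio at `t`; equality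
  -- of scales is covered by A ≥ 1.
  have hone : ∀ s, 0 < s → s ≤ t → f s ≤ A * (f t / f (t / γ)) * f (s / γ) := by
    intro s hs hst
    have hfs := hf.pos (s / γ) (by positivity)
    have hft := hf.pos (t / γ) (by positivity)
    rcases hst.eq_or_lt with rfl | hlt
    · rw [mul_assoc, div_mul_cancel₀ _ hfs.ne']
      exact le_mul_of_one_le_left (hf.pos _ hs).le hA
    · have := hf.ratio_le (s / γ) (t / γ) (by positivity) (by gcongr)
      rwa [mul_div_cancel₀ _ hγ0.ne', mul_div_cancel₀ _ hγ0.ne', div_le_iff₀ hfs] at this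
  have hL : 0 ≤ A * (f t / f (t / γ)) :=
    mul_nonneg (by linarith) (div_nonneg (hf.pos _ ht).le (hf.pos _ (by positivity)).le)
  induction k with
  | zero => simp
  | succ k ih =>
    refine ih.trans ?_
    rw [pow_succ, mul_assoc]
    refine mul_le_mul_of_nonneg_left ?_ (pow_nonneg hL _)
    have := hone (s / γ ^ k) (by positivity) ((div_le_self hs.le (one_le_pow₀ hγ.le)).trans hst)
    rwa [div_div, ← pow_succ] at this

theorem le_exp_sum_mul_add_sum {J b c : ℕ → ℝ} (n : ℕ) (hb : ∀ k, 0 ≤ b k) (hc : ∀ k, 0 ≤ c k)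
    (h : ∀ k < n, J k ≤ Real.exp (c k) * (J (k + 1) + b k)) :
    J 0 ≤ Real.exp (∑ k ∈ Finset.range n, c k) * (J n + ∑ k ∈ Finset.range n, b k) := by
  induction n with
  | zero => simp
  | succ n ih =>
    refine (ih fun k hk => h k (by omega)).trans ?_
    rw [Finset.sum_range_succ, Finset.sum_range_succ, Real.exp_add, mul_assoc]
    refine mul_le_mul_of_nonneg_left ?_ (Real.exp_pos _).le
    have h1 := h n (by omega)
    have h2 : ∑ k ∈ Finset.range n, b k ≤ Real.exp (c n) * ∑ k ∈ Finset.range n, b k :=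
      le_mul_of_one_le_left (Finset.sum_nonneg fun k _ => hb k) (Real.one_le_exp (hc n))
    calc _ ≤ Real.exp (c n) * (J (n + 1) + b n) + Real.exp (c n) * ∑ k ∈ Finset.range n, b k :=
          add_le_add h1 h2
      _ = _ := by ring

theorem sum_range_succ_pow_le {g : ℝ} (hg : 2 ≤ g) (m : ℕ) :
    ∑ k ∈ Finset.range (m + 1), g ^ k ≤ 2 * g ^ m := by
  induction m with
  | zero => simp
  | succ m ih =>
    rw [Finset.sum_range_succ]
    have : 0 < g ^ m := by positivity
    have : 2 * g ^ m ≤ g ^ (m + 1) := by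
      rw [pow_succ, mul_comm (g ^ m)]; gcongr
    linarith

/-- The time scales tend to 0 while the increments are floored at 1, so the iteration must stop. -/
theorem exists_lt_pow_stop {g : ℝ} (t R : ℝ) (hg : 2 ≤ g) :
    ∃ n : ℕ, 4 * (t / 2 / g ^ n) < max (R / 8 * (3 / 4) ^ n) 1 := by
  obtain ⟨n, hn⟩ := pow_unbounded_of_one_lt (2 * t) (show 1 < g by linarith)
  refine ⟨n, lt_max_of_lt_right ?_⟩
  have : 0 < g ^ n := by positivity
  rw [div_div, ← mul_div_assoc, div_lt_one (by positivity)]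
  linarith

/-- At the first scale where the space increment exceeds the time scale, the accumulated loss is a
small multiple of the radius. -/
theorem stop_exponent_le {g t R : ℝ} (hg : 2 ≤ g) (ht : 0 < t) (hR : 0 ≤ R) {n : ℕ}
    (hn : 4 * (t / 2 / g ^ n) < max (R / 8 * (3 / 4) ^ n) 1)
    (hlt : ∀ k < n, max (R / 8 * (3 / 4) ^ k) 1 ≤ 4 * (t / 2 / g ^ k)) :
    R ^ 2 / (3072 * t) * n + t / g ^ n / 64 + (-R + 2 * (t / 2 / g ^ n)) ≤ 1 - R / 2 := by
  have h1 : 4 * (t / 2 / g ^ n) < R / 8 + 1 := by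
    refine hn.trans_le (max_le ?_ (by linarith))
    have : (3 / 4 : ℝ) ^ n ≤ 1 := pow_le_one₀ (by norm_num) (by norm_num)
    nlinarith
  have h2 : t / g ^ n = 2 * (t / 2 / g ^ n) := by ring
  have h3 : R ^ 2 / (3072 * t) * n ≤ R / 96 := by
    rcases n with _ | m
    · simp; positivity
    -- The last admissible step m = n - 1 forces R ≤ 16 t (2/3)^m, so that n R ≤ 32 t.
    have h4 := (le_max_left _ _).trans (hlt m (by omega))
    have h5 : ((m : ℝ) + 1) * (2 / 3) ^ m ≤ 2 := by
      have hB := one_add_mul_le_pow (show (-2 : ℝ) ≤ 1 / 2 by norm_num) m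
      have hp : (0 : ℝ) < (2 / 3) ^ m := by positivity
      have : (1 + 1 / 2 : ℝ) ^ m * (2 / 3) ^ m = 1 := by
        rw [← mul_pow]; norm_num
      nlinarith
    have h6 : R ≤ 16 * t * (2 / 3) ^ m := by
      have hgm : (2 : ℝ) ^ m ≤ g ^ m := pow_le_pow_left₀ (by norm_num) hg m
      have h2m : (0 : ℝ) < 2 ^ m := by positivity
      have h7 : 4 * (t / 2 / g ^ m) ≤ 2 * t / 2 ^ m := by
        rw [div_div, ← mul_div_assoc, div_le_div_iff₀ (by positivity) h2m]
        nlinarith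
      have h8 := h4.trans h7
      rw [le_div_iff₀ h2m, mul_assoc, ← mul_pow] at h8
      have e1 : (3 / 4 * 2 : ℝ) ^ m * (2 / 3) ^ m = 1 := by rw [← mul_pow]; norm_num
      have h9 := mul_le_mul_of_nonneg_right h8 (show (0 : ℝ) ≤ (2 / 3) ^ m by positivity)
      rw [mul_assoc, e1] at h9
      linarith
    rw [div_mul_eq_mul_div, div_le_iff₀ (by positivity)]
    have h10 : R * ((m : ℝ) + 1) ≤ 32 * t := by
      calc R * ((m : ℝ) + 1) ≤ 16 * t * (2 / 3) ^ m * ((m : ℝ) + 1) := by gcongr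
        _ = 16 * t * (((m : ℝ) + 1) * (2 / 3) ^ m) := by ring
        _ ≤ 16 * t * 2 := by gcongr
        _ = _ := by ring
    push_cast
    nlinarith
  rw [h2]
  linarith

/-- Each step multiplies the squared increment by 9/16 and divides the time by g ≥ 2, so the
exponent grows by a factor at least 9/8. Bernoulli turns this into the linear growth in k needed to
absorb L^k; 3072 = 8 · 384, where R²/(384t) is the exponent at k = 0. -/
theorem gaussian_increment_ge {g t R : ℝ} (hg : 2 ≤ g) (ht : 0 < t) (k : ℕ) :
    (k + 1) * (R ^ 2 / (3072 * t)) ≤ (R / 8 * (3 / 4) ^ k) ^ 2 / (12 * (t / 2 / g ^ k)) := by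
  have hgk : 0 < g ^ k := by positivity
  have e : (R / 8 * (3 / 4) ^ k) ^ 2 / (12 * (t / 2 / g ^ k)) =
      R ^ 2 / (384 * t) * (9 / 16 * g) ^ k := by
    rw [mul_pow (9 / 16 : ℝ), show (9 / 16 : ℝ) ^ k = ((3 / 4) ^ k) ^ 2 by
      rw [← pow_mul, mul_comm, pow_mul]; norm_num]
    field_simp
    ring
  have h1 : 1 + (k : ℝ) * (1 / 8) ≤ (9 / 16 * g) ^ k :=
    (one_add_mul_le_pow (by norm_num) k).trans
      (pow_le_pow_left₀ (by norm_num) (by linarith) k)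
  rw [e]
  calc (k + 1) * (R ^ 2 / (3072 * t)) = R ^ 2 / (384 * t) * (1 / 8 + (k : ℝ) * (1 / 8)) := by
        field_simp; ring
    _ ≤ R ^ 2 / (384 * t) * (9 / 16 * g) ^ k := by
        gcongr
        linarith

/-! ### Gaussian bounds for the killed kernel -/

namespace WeightedGraph

variable {V : Type u} {Γ : WeightedGraph V} [MetricSpace V]

/-- An on-diagonal bound by a function of regular growth yields a Gaussian bound for the mass of the
kernel far from the starting point. -/
theorem IsAdapted.tailMass_le_gaussian (h : Γ.IsAdapted) (B : Finset V) (o : B) {f : ℝ → ℝ}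
    {A g δ α t R : ℝ} (hA : 1 ≤ A) (hg : 2 ≤ g) (hf : HasRegularGrowth A g f)
    (hδ : ∀ s, 0 < s → f s ≤ A * Real.exp (δ * s)) (hα : 0 < α) (hαg : α ≤ 1 / g)
    (hαδ : δ * α ≤ 1 / 64) (hK : ∀ s, 0 < s → Γ.killedKernel B s o o ≤ 1 / f s)
    (ht : 0 < t) (hR : 0 ≤ R) (hRt : R ≤ t / 2) :
    Γ.tailMass B o R (t / 2) ≤
      Real.exp 4 * A / f (α * t) * Real.exp (-(R ^ 2 / (3072 * t))) := by
  have hg0 : 0 < g := by linarith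
  set a := R ^ 2 / (3072 * t) with ha
  set L := A * (f t / f (t / g)) with hL
  have hft := hf.pos t ht
  have hαt : 0 < α * t := by positivity
  have htg : 0 < t / g := by positivity
  have hαtg : α * t ≤ t / g := by
    rw [div_eq_mul_one_div, mul_comm]; gcongr
  have hftg := hf.pos _ htg
  have hfα := hf.pos _ hαt
  have hfα1 : f (α * t) ≤ f (t / g) := hf.mono hαt htg hαtg
  have hgt : t / g ≤ t := div_le_self ht.le (by linarith)
  have hL0 : 0 < L := by positivity
  have hmono : ∀ {c : ℝ}, 0 ≤ c → c / f (t / g) ≤ c / f (α * t) := fun hc => by gcongr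
  have hRa : a ≤ R / 2 := by
    rw [ha, div_le_iff₀ (by positivity)]; nlinarith
  have hexp4 : (5 : ℝ) ≤ Real.exp 4 := by linarith [Real.add_one_le_exp (4 : ℝ)]
  -- If exp a < 2L, the on-diagonal bound at `t` already contains the Gaussian factor. Otherwise L
  -- exp(-a) ≤ 1/2, and the errors of the iteration form a geometric series.
  rcases lt_or_ge (Real.exp a) (2 * L) with hcase | hcase
  · have h1 : Γ.tailMass B o R (t / 2) ≤ 1 / f t := by
      refine (Γ.tailMass_le_diag B o R _).trans ?_
      rw [mul_div_cancel₀ _ (two_ne_zero)]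
      exact hK t ht
    refine h1.trans ?_
    have h2 : 1 / f t ≤ 2 * A / f (t / g) * Real.exp (-a) := by
      rw [Real.exp_neg, ← div_eq_mul_inv, le_div_iff₀ (Real.exp_pos _), div_mul_eq_mul_div, one_mul,
        div_le_iff₀ hft]
      refine hcase.le.trans (le_of_eq ?_)
      rw [hL]; ring
    refine h2.trans ((mul_le_mul_of_nonneg_right (hmono (by linarith)) (Real.exp_pos _).le).trans ?_)
    gcongr
    linarith
  · classical
    let n := Nat.find (exists_lt_pow_stop t R hg)
    have hn : 4 * (t / 2 / g ^ n) < max (R / 8 * (3 / 4) ^ n) 1 :=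
      Nat.find_spec (exists_lt_pow_stop t R hg)
    have hlt : ∀ k < n, max (R / 8 * (3 / 4) ^ k) 1 ≤ 4 * (t / 2 / g ^ k) := fun k hk =>
      not_lt.1 (Nat.find_min (exists_lt_pow_stop t R hg) hk)
    have hLa : L * Real.exp (-a) ≤ 1 / 2 := by
      rw [Real.exp_neg, ← div_eq_mul_inv, div_le_iff₀ (Real.exp_pos _)]; linarith
    have hLe : L ≤ Real.exp a := by linarith
    -- The radii decrease from R towards R/2 with increments (R/8)(3/4)^k, and the times are t/(2
    -- g^k).
    set J : ℕ → ℝ := fun k => Γ.tailMass B o (R / 2 + R / 2 * (3 / 4) ^ k) (t / 2 / g ^ k) with hJ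
    set b : ℕ → ℝ := fun k => Real.exp (-a) * (1 / 2) ^ k / f (t / g) with hb
    set c : ℕ → ℝ := fun k => 1 / (6 * (t / 2 / g ^ k)) with hc
    have hstep : ∀ k < n, J k ≤ Real.exp (c k) * (J (k + 1) + b k) := by
      intro k hk
      have hgk : 0 < g ^ k := by positivity
      have hdiff : R / 2 + R / 2 * (3 / 4) ^ k - (R / 2 + R / 2 * (3 / 4) ^ (k + 1)) =
          R / 8 * (3 / 4) ^ k := by ring
      have h1 := h.tailMass_step B o (R := R / 2 + R / 2 * (3 / 4) ^ k)
        (r := R / 2 + R / 2 * (3 / 4) ^ (k + 1)) (τ := t / 2 / g ^ k) (τ' := t / 2 / g ^ (k + 1))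
        (by positivity) (by positivity)
        (by gcongr
            · linarith
            · omega)
        (by rw [← sub_nonneg, hdiff]; positivity) (by rw [hdiff]; exact hlt k hk)
      refine h1.trans (mul_le_mul_of_nonneg_left (add_le_add le_rfl ?_) (Real.exp_pos _).le)
      rw [hdiff]
      have e2 : 2 * (t / 2 / g ^ (k + 1)) = t / g / g ^ k := by
        rw [pow_succ]; field_simp
      rw [e2]
      have h2 : Γ.killedKernel B (t / g / g ^ k) o o ≤ L ^ k / f (t / g) := by
        refine (hK _ (by positivity)).trans ?_
        rw [div_le_div_iff₀ (hf.pos _ (by positivity)) hftg, one_mul]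
        exact hf.le_pow_mul hA (by linarith) htg hgt k
      have h3 : Real.exp (-((R / 8 * (3 / 4) ^ k) ^ 2 / (12 * (t / 2 / g ^ k)))) ≤
          Real.exp (-a) * Real.exp (-a) ^ k := by
        rw [← Real.exp_nat_mul, ← Real.exp_add, Real.exp_le_exp]
        have := gaussian_increment_ge (R := R) hg ht k
        linarith
      calc _ ≤ Real.exp (-a) * Real.exp (-a) ^ k * (L ^ k / f (t / g)) := by
            refine mul_le_mul h3 h2 ?_ (by positivity)
            have := Γ.killedKernel_two_mul_diag B (t / g / g ^ k / 2) o
            rw [mul_div_cancel₀ _ (two_ne_zero)] at this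
            rw [this]
            positivity
        _ = Real.exp (-a) * (L * Real.exp (-a)) ^ k / f (t / g) := by rw [mul_pow]; ring
        _ ≤ b k := by
            simp only [hb]
            gcongr
    have hiter := le_exp_sum_mul_add_sum n (fun k => by simp only [hb]; positivity)
      (fun k => by simp only [hc]; positivity) hstep
    have hJ0 : J 0 = Γ.tailMass B o R (t / 2) := by
      simp only [hJ, pow_zero, mul_one, div_one, add_halves]
    rw [hJ0] at hiter
    have hsumc : ∑ k ∈ Finset.range n, c k ≤ 4 / 3 := by
      have e : ∀ k, c k = g ^ k * (1 / (3 * t)) := by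
        intro k
        simp only [hc]
        field_simp
        ring
      simp_rw [e, ← Finset.sum_mul]
      rcases hn' : n with _ | m
      · norm_num
      have h1 := sum_range_succ_pow_le hg m
      -- The floor 1 in the last admissible step gives g^m ≤ 2t, which bounds the whole sum of
      -- losses.
      have h2 := (le_max_right _ _).trans (hlt m (by omega))
      have hgm : 0 < g ^ m := by positivity
      rw [div_div, ← mul_div_assoc, le_div_iff₀ (by positivity)] at h2
      rw [mul_one_div, div_le_iff₀ (by positivity)]
      linarith
    have hsumb : ∑ k ∈ Finset.range n, b k ≤ 2 * A / f (α * t) * Real.exp (-a) := by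
      have h1 : ∑ k ∈ Finset.range n, b k =
          Real.exp (-a) / f (t / g) * ∑ k ∈ Finset.range n, (1 / 2 : ℝ) ^ k := by
        rw [Finset.mul_sum]
        exact Finset.sum_congr rfl fun k _ => by simp only [hb]; ring
      rw [h1]
      calc _ ≤ Real.exp (-a) / f (α * t) * 2 := by
            refine mul_le_mul (hmono (Real.exp_pos _).le) (sum_geometric_two_le n)
              (Finset.sum_nonneg fun _ _ => by positivity) (by positivity)
        _ = 2 * 1 / f (α * t) * Real.exp (-a) := by ring
        _ ≤ _ := by gcongr
    have hJn : J n ≤ Real.exp 1 * A / f (α * t) * Real.exp (-a) := by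
      have h1 : J n ≤ Real.exp (-R + 2 * (t / 2 / g ^ n)) := by
        refine (h.tailMass_le_exp B o _ (by positivity)).trans (Real.exp_le_exp.2 ?_)
        have : 0 ≤ R / 2 * (3 / 4) ^ n := by positivity
        linarith
      -- The factor 1 / f(αt) is bought back here: descend n scales by regularity, then apply the
      -- exponential growth bound, with δα ≤ 1/64 keeping its exponent small.
      have h2 : f (α * t) ≤ Real.exp (a * n) * (A * Real.exp (t / g ^ n / 64)) := by
        refine (hf.le_pow_mul hA (by linarith) hαt (hαtg.trans hgt) n).trans ?_
        have h3 : L ^ n ≤ Real.exp (a * n) := by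
          rw [mul_comm, Real.exp_nat_mul]
          exact pow_le_pow_left₀ hL0.le hLe n
        refine mul_le_mul h3 ((hδ _ (by positivity)).trans ?_) (hf.pos _ (by positivity)).le
          (Real.exp_pos _).le
        gcongr
        rw [show δ * (α * t / g ^ n) = (δ * α) * (t / g ^ n) by ring]
        have : 0 < t / g ^ n := by positivity
        nlinarith
      rw [div_mul_eq_mul_div, le_div_iff₀ hfα]
      calc J n * f (α * t) ≤ Real.exp (-R + 2 * (t / 2 / g ^ n)) *
            (Real.exp (a * n) * (A * Real.exp (t / g ^ n / 64))) := by
            refine mul_le_mul h1 h2 hfα.le (Real.exp_pos _).le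
        _ = A * Real.exp (a * n + t / g ^ n / 64 + (-R + 2 * (t / 2 / g ^ n))) := by
            rw [Real.exp_add (a * n + t / g ^ n / 64), Real.exp_add (a * n)]; ring
        _ ≤ A * Real.exp (1 + -a) := by
            have := stop_exponent_le hg ht hR hn hlt
            refine mul_le_mul_of_nonneg_left (Real.exp_le_exp.2 ?_) (by linarith)
            linarith
        _ = _ := by rw [Real.exp_add]; ring
    have hF : 0 ≤ A / f (α * t) * Real.exp (-a) := by positivity
    have hnum : Real.exp (4 / 3) * (Real.exp 1 + 2) ≤ Real.exp 4 := by
      have e1 : Real.exp 1 + 2 ≤ Real.exp 2 := by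
        have : Real.exp 2 = Real.exp 1 * Real.exp 1 := by rw [← Real.exp_add]; norm_num
        have := Real.exp_one_gt_d9
        nlinarith
      calc _ ≤ Real.exp (4 / 3) * Real.exp 2 := by gcongr
        _ = Real.exp (4 / 3 + 2) := by rw [Real.exp_add]
        _ ≤ _ := Real.exp_le_exp.2 (by norm_num)
    calc _ ≤ Real.exp (∑ k ∈ Finset.range n, c k) * (J n + ∑ k ∈ Finset.range n, b k) := hiter
      _ ≤ Real.exp (4 / 3) * (Real.exp 1 * A / f (α * t) * Real.exp (-a) +
          2 * A / f (α * t) * Real.exp (-a)) := by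
          refine mul_le_mul (Real.exp_le_exp.2 hsumc) (add_le_add hJn hsumb) ?_ (Real.exp_pos _).le
          exact add_nonneg (Γ.tailMass_nonneg _ _ _ _)
            (Finset.sum_nonneg fun _ _ => by simp only [hb]; positivity)
      _ = Real.exp (4 / 3) * (Real.exp 1 + 2) * (A / f (α * t) * Real.exp (-a)) := by ring
      _ ≤ Real.exp 4 * (A / f (α * t) * Real.exp (-a)) :=
          mul_le_mul_of_nonneg_right hnum hF
      _ = _ := by ring

/-- The off-diagonal kernel is controlled by the masses of the two kernels far from their poles. -/
theorem killedKernel_le_tailMass (B : Finset V) (x y : B) (t : ℝ) :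
    Γ.killedKernel B t x y ≤
      √(Γ.tailMass B x (dist (x : V) y / 2) (t / 2) * Γ.killedKernel B t y y) +
      √(Γ.killedKernel B t x x * Γ.tailMass B y (dist (x : V) y / 2) (t / 2)) := by
  classical
  set D := dist (x : V) y
  set K := Γ.killedKernel B (t / 2)
  have hsplit : Γ.killedKernel B t x y = ∑ z, K z x * K z y := by
    conv_lhs => rw [← add_halves t, killedKernel_add, Matrix.mul_apply]
    exact Finset.sum_congr rfl fun z _ => by rw [Γ.killedKernel_symm B _ x z]
  have hdiag : ∀ x, Γ.killedKernel B t x x = ∑ z, K z x ^ 2 := by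
    intro x
    rw [← killedKernel_two_mul_diag, mul_div_cancel₀ _ (two_ne_zero)]
  set p : B → ℝ := fun z => if D / 2 ≤ dist (x : V) z then K z x else 0
  set q : B → ℝ := fun z => if D / 2 ≤ dist (y : V) z then K z y else 0
  have hp : ∑ z, p z ^ 2 = Γ.tailMass B x (D / 2) (t / 2) :=
    Finset.sum_congr rfl fun z _ => by simp only [p, ite_pow]; simp [K]
  have hq : ∑ z, q z ^ 2 = Γ.tailMass B y (D / 2) (t / 2) :=
    Finset.sum_congr rfl fun z _ => by simp only [q, ite_pow]; simp [K]
  rw [hsplit, hdiag, hdiag, ← hp, ← hq, Real.sqrt_mul (Finset.sum_nonneg fun _ _ => sq_nonneg _),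
    Real.sqrt_mul (Finset.sum_nonneg fun _ _ => sq_nonneg _)]
  have hpp : ∑ z, p z ^ 2 = ∑ z, |p z| ^ 2 := by simp
  have hqq : ∑ z, q z ^ 2 = ∑ z, |q z| ^ 2 := by simp
  have hxx : ∑ z, K z x ^ 2 = ∑ z, |K z x| ^ 2 := by simp
  have hyy : ∑ z, K z y ^ 2 = ∑ z, |K z y| ^ 2 := by simp
  rw [hpp, hqq, hxx, hyy]
  refine le_trans ?_ (add_le_add (Real.sum_mul_le_sqrt_mul_sqrt _ _ _)
    (Real.sum_mul_le_sqrt_mul_sqrt _ _ _))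
  rw [← Finset.sum_add_distrib]
  refine Finset.sum_le_sum fun z _ => ?_
  have h0 : K z x * K z y ≤ |K z x| * |K z y| := (le_abs_self _).trans (abs_mul _ _).le
  refine h0.trans ?_
  rcases le_or_gt (D / 2) (dist (x : V) z) with hz | hz
  · simp only [p, if_pos hz]
    have : 0 ≤ |K z x| * |q z| := by positivity
    linarith
  · have hz2 : D / 2 ≤ dist (y : V) z := by
      have := dist_triangle_right (x : V) y z
      linarith
    simp only [q, if_pos hz2]
    have : 0 ≤ |p z| * |K z y| := by positivity
    linarith

/-- Each square root is a geometric mean of a tail bound and a diagonal bound, whence the product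
f₁f₂. The exponent constant is 24576 = 2 · 4 · 3072: the root gives 2 and the radius D/2 gives 4. -/
theorem IsAdapted.killedKernel_le_gaussian (h : Γ.IsAdapted) (B : Finset V) (x y : B)
    {f₁ f₂ : ℝ → ℝ} {A g δ α t : ℝ} (hA : 1 ≤ A) (hg : 2 ≤ g)
    (hf₁ : HasRegularGrowth A g f₁) (hf₂ : HasRegularGrowth A g f₂)
    (hδ₁ : ∀ s, 0 < s → f₁ s ≤ A * Real.exp (δ * s))
    (hδ₂ : ∀ s, 0 < s → f₂ s ≤ A * Real.exp (δ * s)) (hα : 0 < α) (hαg : α ≤ 1 / g)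
    (hαδ : δ * α ≤ 1 / 64) (hK₁ : ∀ s, 0 < s → Γ.killedKernel B s x x ≤ 1 / f₁ s)
    (hK₂ : ∀ s, 0 < s → Γ.killedKernel B s y y ≤ 1 / f₂ s)
    (ht : 0 < t) (hdt : dist (x : V) y ≤ t) :
    Γ.killedKernel B t x y ≤ 2 * Real.exp 2 * A / √(f₁ (α * t) * f₂ (α * t)) *
      Real.exp (-(1 / 24576) * (dist (x : V) y ^ 2 / t)) := by
  set D := dist (x : V) y with hD
  have hD0 : 0 ≤ D := dist_nonneg
  have hαt : 0 < α * t := by positivity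
  have hαt' : α * t ≤ t := by
    have : 1 / g ≤ 1 := by rw [div_le_one (by linarith)]; linarith
    nlinarith
  have hp₁ := hf₁.pos _ hαt
  have hp₂ := hf₂.pos _ hαt
  have d₁ : Γ.killedKernel B t x x ≤ 1 / f₁ (α * t) :=
    (hK₁ t ht).trans (one_div_le_one_div_of_le hp₁ (hf₁.mono hαt ht hαt'))
  have d₂ : Γ.killedKernel B t y y ≤ 1 / f₂ (α * t) :=
    (hK₂ t ht).trans (one_div_le_one_div_of_le hp₂ (hf₂.mono hαt ht hαt'))
  have J₁ := h.tailMass_le_gaussian B x hA hg hf₁ hδ₁ hα hαg hαδ hK₁ ht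
    (show 0 ≤ D / 2 by linarith) (by linarith)
  have J₂ := h.tailMass_le_gaussian B y hA hg hf₂ hδ₂ hα hαg hαδ hK₂ ht
    (show 0 ≤ D / 2 by linarith) (by linarith)
  have hdiag : ∀ x, 0 ≤ Γ.killedKernel B t x x := by
    intro x
    have := Γ.killedKernel_two_mul_diag B (t / 2) x
    rw [mul_div_cancel₀ _ (two_ne_zero)] at this
    rw [this]
    positivity
  set F := f₁ (α * t) * f₂ (α * t) with hF
  have hFpos : 0 < F := mul_pos hp₁ hp₂
  set X := Real.exp 2 * A / √F * Real.exp (-(1 / 24576) * (D ^ 2 / t)) with hX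
  have hX0 : 0 ≤ X := by positivity
  have hbound : Real.exp 4 * A * Real.exp (-((D / 2) ^ 2 / (3072 * t))) / F ≤ X ^ 2 := by
    have e : X ^ 2 = Real.exp 4 * A ^ 2 * Real.exp (-((D / 2) ^ 2 / (3072 * t))) / F := by
      rw [hX, mul_pow, div_pow, mul_pow, Real.sq_sqrt hFpos.le, ← Real.exp_nat_mul,
        ← Real.exp_nat_mul]
      have : ((2 : ℕ) : ℝ) * (-(1 / 24576) * (D ^ 2 / t)) = -((D / 2) ^ 2 / (3072 * t)) := by
        push_cast; field_simp; ring
      rw [this]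
      norm_num
      ring
    rw [e]
    gcongr
    nlinarith
  have s₁ : √(Γ.tailMass B x (D / 2) (t / 2) * Γ.killedKernel B t y y) ≤ X := by
    refine Real.sqrt_le_iff.2 ⟨hX0, le_trans ?_ hbound⟩
    refine (mul_le_mul J₁ d₂ (hdiag y) (by positivity)).trans (le_of_eq ?_)
    rw [hF]; field_simp
  have s₂ : √(Γ.killedKernel B t x x * Γ.tailMass B y (D / 2) (t / 2)) ≤ X := by
    refine Real.sqrt_le_iff.2 ⟨hX0, le_trans ?_ hbound⟩
    refine (mul_le_mul d₁ J₂ (Γ.tailMass_nonneg _ _ _ _) (by positivity)).trans (le_of_eq ?_)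
    rw [hF]; field_simp
  refine (killedKernel_le_tailMass B x y t).trans ((add_le_add s₁ s₂).trans (le_of_eq ?_))
  rw [hX]; ring

end WeightedGraph

/-! ### Passing to a scale ratio of at least 2 -/

theorem HasRegularGrowth.iterate {A γ : ℝ} {f : ℝ → ℝ} (hf : HasRegularGrowth A γ f) (hA : 1 ≤ A)
    (hγ : 1 < γ) (n : ℕ) : HasRegularGrowth (A ^ n) (γ ^ n) f where
  pos := hf.pos
  mono := hf.mono
  ratio_le s t hs hst := by
    have hγ0 : 0 < γ := by linarith
    have ht := hs.trans hst
    induction n with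
    | zero => simp [div_self (hf.pos s hs).ne', div_self (hf.pos t ht).ne']
    | succ n ih =>
      have h1 := hf.ratio_le (γ ^ n * s) (γ ^ n * t) (by positivity) (by gcongr)
      have p1 := hf.pos (γ ^ n * s) (by positivity)
      have p2 := hf.pos (γ ^ n * t) (by positivity)
      have p3 := hf.pos s hs
      have p4 := hf.pos t ht
      have p5 := hf.pos (γ * (γ ^ n * s)) (by positivity)
      have := mul_le_mul h1 ih (by positivity)
        (mul_nonneg (by linarith) (div_nonneg (hf.pos _ (by positivity)).le p2.le))
      rw [pow_succ' γ, mul_assoc, mul_assoc]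
      calc _ = f (γ * (γ ^ n * s)) / f (γ ^ n * s) * (f (γ ^ n * s) / f s) := by
            field_simp
        _ ≤ _ := this
        _ = _ := by field_simp; ring

/-- The iteration over scales needs a ratio of at least 2, so γ is replaced by γ^β and A by A^β. The
upper bound 2γ is the source of (2γ)⁻¹ in α. -/
theorem pow_ceil_log_two_bounds {γ : ℝ} (hγ : 1 < γ) {β : ℕ}
    (hβ : β = ⌈Real.log 2 / Real.log γ⌉₊) : 1 ≤ β ∧ 2 ≤ γ ^ β ∧ γ ^ β ≤ 2 * γ := by
  have hlog := Real.log_pos hγ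
  have hγ0 : 0 < γ := by linarith
  have h2 := Real.log_pos (show (1 : ℝ) < 2 by norm_num)
  have hpos : 0 < Real.log 2 / Real.log γ := by positivity
  have hle := Nat.le_ceil (Real.log 2 / Real.log γ)
  have hlt := Nat.ceil_lt_add_one hpos.le
  rw [← hβ] at hle hlt
  refine ⟨?_, ?_, ?_⟩
  · rw [hβ]; exact Nat.ceil_pos.2 hpos
  · rw [div_le_iff₀ hlog] at hle
    rw [← Real.log_le_log_iff (by norm_num) (by positivity), Real.log_pow]
    exact hle
  · rw [← sub_lt_iff_lt_add, lt_div_iff₀ hlog] at hlt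
    rw [← Real.log_le_log_iff (by positivity) (by positivity), Real.log_pow,
      Real.log_mul (by norm_num) hγ0.ne']
    linarith

/-! ### Exponential clocks and the number of jumps -/

/-- The probability that a chain with successive jump rates `q 0, q 1, …` has made exactly `n` jumps
by time `t`, defined through the first-jump decomposition. -/
noncomputable def holdProb : ℕ → (ℕ → ℝ) → ℝ → ℝ
  | 0, q, t => Real.exp (-(q 0 * t))
  | n + 1, q, t => q 0 * Real.exp (-(q 0 * t)) *
      ∫ r in (0 : ℝ)..t, Real.exp (q 0 * r) * holdProb n (fun k => q (k + 1)) r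

theorem continuous_holdProb (n : ℕ) (q : ℕ → ℝ) : Continuous (holdProb n q) := by
  induction n generalizing q with
  | zero =>
    change Continuous fun t => Real.exp (-(q 0 * t))
    fun_prop
  | succ n ih =>
    have := ih fun k => q (k + 1)
    change Continuous fun t => q 0 * Real.exp (-(q 0 * t)) *
      ∫ r in (0 : ℝ)..t, Real.exp (q 0 * r) * holdProb n (fun k => q (k + 1)) r
    refine Continuous.mul (by fun_prop) (intervalIntegral.continuous_primitive ?_ 0)
    exact fun a b => (Continuous.intervalIntegrable (by fun_prop) a b)

theorem holdProb_nonneg (n : ℕ) {q : ℕ → ℝ} (hq : ∀ k, 0 ≤ q k) {t : ℝ} (ht : 0 ≤ t) :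
    0 ≤ holdProb n q t := by
  induction n generalizing q t with
  | zero => unfold holdProb; positivity
  | succ n ih =>
    unfold holdProb
    refine mul_nonneg (mul_nonneg (hq 0) (Real.exp_pos _).le)
      (intervalIntegral.integral_nonneg ht fun r hr => ?_)
    exact mul_nonneg (Real.exp_pos _).le (ih (fun k => hq (k + 1)) hr.1)

theorem measure_lt_of_map_eq_expMeasure {Ω : Type v} [MeasurableSpace Ω] {P : Measure Ω}
    [IsProbabilityMeasure P] {E : Ω → ℝ} (hE : Measurable E) (hlaw : P.map E = expMeasure 1)
    {c : ℝ} (hc : 0 ≤ c) : P {ω | c < E ω} = ENNReal.ofReal (Real.exp (-c)) := by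
  have h1 : P {ω | c < E ω} = expMeasure 1 (Set.Ioi c) := by
    rw [← hlaw, Measure.map_apply hE measurableSet_Ioi]; rfl
  have := isProbabilityMeasure_expMeasure (r := 1) one_pos
  have h2 : (expMeasure 1).real (Set.Iic c) = 1 - Real.exp (-c) := by
    rw [← cdf_eq_real, cdf_expMeasure_eq one_pos, if_pos hc, one_mul]
  have h3 : (expMeasure 1).real (Set.Ioi c) = Real.exp (-c) := by
    rw [← Set.compl_Iic, probReal_compl_eq_one_sub measurableSet_Iic, h2]; ring
  rw [h1, ← h3, ofReal_measureReal]

theorem ProbabilityTheory.iIndepFun.indepFun_zero_shift {Ω : Type v} [MeasurableSpace Ω] {P : Measure Ω}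
    {E : ℕ → Ω → ℝ} (hind : iIndepFun E P) (hE : ∀ k, Measurable (E k)) (n : ℕ) {β : Type*}
    [MeasurableSpace β] {F : (Fin n → ℝ) → β} (hF : Measurable F) :
    IndepFun (E 0) (fun ω => F fun i => E (i + 1) ω) P := by
  have h := hind.indepFun_finset {0} ((Finset.range n).map (addRightEmbedding 1))
    (by simp) hE
  have h0 : Measurable fun f : ((({0} : Finset ℕ) : Type) → ℝ) => f ⟨0, by simp⟩ :=
    measurable_pi_apply _
  have h1 : Measurable fun f : (((Finset.range n).map (addRightEmbedding 1) : Finset ℕ) → ℝ) =>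
      F fun i => f ⟨i + 1, by simp⟩ :=
    hF.comp (measurable_pi_lambda _ fun i => measurable_pi_apply _)
  exact h.comp h0 h1

theorem ProbabilityTheory.iIndepFun.shift {Ω : Type v} [MeasurableSpace Ω] {P : Measure Ω}
    {E : ℕ → Ω → ℝ} (hind : iIndepFun E P) : iIndepFun (fun k => E (k + 1)) P :=
  hind.precomp (add_left_injective 1)

theorem lintegral_expMeasure_one {F : ℝ → ENNReal} (hF : Measurable F) :
    ∫⁻ s, F s ∂(expMeasure 1) = ∫⁻ s in Set.Ioi 0, ENNReal.ofReal (Real.exp (-s)) * F s := by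
  have h : expMeasure 1 = volume.withDensity (exponentialPDF 1) := rfl
  have hm : Measurable (exponentialPDF 1) := (measurable_exponentialPDFReal 1).ennreal_ofReal
  rw [h, lintegral_withDensity_eq_lintegral_mul _ hm hF, ← lintegral_indicator measurableSet_Ioi]
  have h0 : ∀ᵐ s : ℝ, s ≠ 0 := by simp [ae_iff]
  refine lintegral_congr_ae ?_
  filter_upwards [h0] with s hs
  by_cases hp : 0 < s
  · rw [Set.indicator_of_mem (Set.mem_Ioi.2 hp), Pi.mul_apply, exponentialPDF_of_nonneg hp.le]
    simp
  · rw [Set.indicator_of_notMem (by simpa using hp), Pi.mul_apply,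
      exponentialPDF_of_neg (lt_of_le_of_ne (not_lt.1 hp) hs), zero_mul]

/-- Substitute s = q(t - r), with r the time left after the first jump. For q = 0 both sides vanish.
-/
theorem integral_first_jump {q t : ℝ} (h : ℝ → ℝ) :
    ∫ s in (0 : ℝ)..(q * t), Real.exp (-s) * h (t - s / q) =
      q * Real.exp (-(q * t)) * ∫ r in (0 : ℝ)..t, Real.exp (q * r) * h r := by
  rcases eq_or_ne q 0 with rfl | hq
  · simp
  have h1 := intervalIntegral.smul_integral_comp_sub_mul (a := 0) (b := t)
    (fun s => Real.exp (-s) * h (t - s / q)) q (q * t)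
  rw [mul_zero, sub_zero, sub_self] at h1
  rw [← h1, smul_eq_mul, mul_assoc, ← intervalIntegral.integral_const_mul (Real.exp (-(q * t)))]
  congr 1
  refine intervalIntegral.integral_congr fun r _ => ?_
  change Real.exp (-(q * t - q * r)) * h (t - (q * t - q * r) / q) =
    Real.exp (-(q * t)) * (Real.exp (q * r) * h r)
  rw [show -(q * t - q * r) = -(q * t) + q * r by ring, Real.exp_add, mul_assoc]
  congr 3
  field_simp
  ring

/-- The number of jumps by time `t` has the law `holdProb`. -/
theorem measure_sum_exponential {Ω : Type v} [MeasurableSpace Ω] {P : Measure Ω}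
    [IsProbabilityMeasure P] (n : ℕ) {E : ℕ → Ω → ℝ} (hE : ∀ k, Measurable (E k))
    (hind : iIndepFun E P) (hlaw : ∀ k, P.map (E k) = expMeasure 1) {q : ℕ → ℝ}
    (hq : ∀ k, 0 ≤ q k) {t : ℝ} (ht : 0 ≤ t) :
    P {ω | ∑ k ∈ Finset.range n, ENNReal.ofReal (E k ω) / ENNReal.ofReal (q k) ≤
          ENNReal.ofReal t ∧
        ENNReal.ofReal t <
          ∑ k ∈ Finset.range (n + 1), ENNReal.ofReal (E k ω) / ENNReal.ofReal (q k)} =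
      ENNReal.ofReal (holdProb n q t) := by
  induction n generalizing E q t with
  | zero =>
    rw [holdProb, ← measure_lt_of_map_eq_expMeasure (hE 0) (hlaw 0) (mul_nonneg (hq 0) ht)]
    congr 1
    ext ω
    simp only [Finset.range_zero, Finset.sum_empty, zero_le, true_and, zero_add,
      Finset.sum_range_one, Set.mem_ofPred_eq]
    -- At rate 0 a positive clock divided by 0 is `⊤`, an infinite holding time, while 0 / 0 = 0;
    -- both agree with the threshold 0.
    rcases (hq 0).eq_or_lt with h0 | h0
    · rw [← h0, zero_mul, ENNReal.ofReal_zero]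
      by_cases hp : 0 < E 0 ω
      · simp [ENNReal.div_zero (ENNReal.ofReal_pos.2 hp).ne', hp]
      · simp [ENNReal.ofReal_of_nonpos (not_lt.1 hp), hp]
    · rw [← ENNReal.ofReal_div_of_pos h0]
      rcases le_or_gt (E 0 ω) 0 with hp | hp
      · have h1 : E 0 ω / q 0 ≤ 0 := div_nonpos_of_nonpos_of_nonneg hp h0.le
        have h2 : ¬ q 0 * t < E 0 ω := by
          have : 0 ≤ q 0 * t := by positivity
          linarith
        simp [ENNReal.ofReal_of_nonpos h1, h2]
      · rw [ENNReal.ofReal_lt_ofReal_iff (by positivity), lt_div_iff₀ h0, mul_comm]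
  | succ n ih =>
    set T := ENNReal.ofReal t with hT
    set e : ℝ → ENNReal := fun s => ENNReal.ofReal s / ENNReal.ofReal (q 0) with he
    have hem : Measurable e := ENNReal.measurable_ofReal.div_const _
    set S : ℕ → (ℕ → ℝ) → ENNReal := fun m f =>
      ∑ k ∈ Finset.range m, ENNReal.ofReal (f k) / ENNReal.ofReal (q (k + 1)) with hS
    have hSm : ∀ m, Measurable fun ω => S m fun k => E (k + 1) ω := fun m =>
      Finset.measurable_fun_sum _ fun k _ => (hE (k + 1)).ennreal_ofReal.div_const _
    have hindS : IndepFun (E 0)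
        (fun ω => (S n (fun k => E (k + 1) ω), S (n + 1) fun k => E (k + 1) ω)) P := by
      have hF : Measurable fun f : Fin (n + 1) → ℝ =>
          (∑ k : Fin n, ENNReal.ofReal (f k.castSucc) / ENNReal.ofReal (q (k + 1)),
            ∑ k : Fin (n + 1), ENNReal.ofReal (f k) / ENNReal.ofReal (q (k + 1))) := by
        fun_prop
      have := hind.indepFun_zero_shift hE (n + 1) hF
      simpa only [hS, Finset.sum_range, Fin.val_castSucc] using this
    have hpairm : Measurable fun ω =>
        (S n (fun k => E (k + 1) ω), S (n + 1) fun k => E (k + 1) ω) := (hSm n).prodMk (hSm (n + 1))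
    set D : Set (ℝ × (ENNReal × ENNReal)) :=
      {p | e p.1 + p.2.1 ≤ T ∧ T < e p.1 + p.2.2} with hD
    have hDm : MeasurableSet D := by
      have h1 : Measurable fun p : ℝ × (ENNReal × ENNReal) => e p.1 + p.2.1 := by fun_prop
      have h2 : Measurable fun p : ℝ × (ENNReal × ENNReal) => e p.1 + p.2.2 := by fun_prop
      exact (measurableSet_le h1 measurable_const).inter (measurableSet_lt measurable_const h2)
    have hev : {ω | ∑ k ∈ Finset.range (n + 1), ENNReal.ofReal (E k ω) / ENNReal.ofReal (q k) ≤ T ∧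
        T < ∑ k ∈ Finset.range (n + 1 + 1), ENNReal.ofReal (E k ω) / ENNReal.ofReal (q k)} =
        (fun ω => (E 0 ω, (S n (fun k => E (k + 1) ω), S (n + 1) fun k => E (k + 1) ω))) ⁻¹' D := by
      ext ω
      simp only [Set.mem_ofPred_eq, Set.mem_preimage, hD, hS, he]
      rw [Finset.sum_range_succ' _ n, Finset.sum_range_succ' _ (n + 1), add_comm (_ / _),
        add_comm (ENNReal.ofReal (E 0 ω) / ENNReal.ofReal (q 0))]
    rw [hev, ← Measure.map_apply ((hE 0).prodMk hpairm) hDm,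
      (indepFun_iff_map_prod_eq_prod_map_map (hE 0).aemeasurable hpairm.aemeasurable).1 hindS,
      hlaw 0]
    have := Measure.isProbabilityMeasure_map (μ := P) hpairm.aemeasurable
    have := isProbabilityMeasure_expMeasure (r := 1) one_pos
    rw [Measure.prod_apply hDm, lintegral_expMeasure_one (measurable_measure_prodMk_left hDm)]
    set h := holdProb n fun k => q (k + 1) with hh
    have hcont : Continuous h := continuous_holdProb _ _
    -- Given the first clock value s, the remaining clocks face the same problem with time t - s / q
    -- 0; nothing remains if the first jump comes after t.
    have hint : ∀ s ∈ Set.Ioi (0 : ℝ),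
        ENNReal.ofReal (Real.exp (-s)) * (P.map fun ω =>
          (S n (fun k => E (k + 1) ω), S (n + 1) fun k => E (k + 1) ω)) (Prod.mk s ⁻¹' D) =
        (Set.Iic (q 0 * t)).indicator
          (fun s => ENNReal.ofReal (Real.exp (-s) * h (t - s / q 0))) s := by
      intro s hs
      have hs : 0 < s := hs
      rw [Measure.map_apply hpairm (measurable_prodMk_left hDm)]
      have hempty : T < e s → Prod.mk s ⁻¹' D = ∅ := by
        intro hlt
        ext p
        simp only [hD, Set.mem_preimage, Set.mem_ofPred_eq, Set.mem_empty_iff_false, iff_false,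
          not_and]
        intro hle
        exact absurd (le_self_add.trans hle) hlt.not_ge
      rcases (hq 0).eq_or_lt with h0 | h0
      · have : e s = ⊤ := by
          simp only [he]
          rw [← h0, ENNReal.ofReal_zero, ENNReal.div_zero (ENNReal.ofReal_pos.2 hs).ne']
        rw [hempty (by rw [this]; exact ENNReal.ofReal_lt_top), ← h0, Set.indicator_of_notMem]
        · simp
        · simpa using hs
      · have hes : e s = ENNReal.ofReal (s / q 0) := (ENNReal.ofReal_div_of_pos h0).symm
        by_cases hst : s ≤ q 0 * t
        · have hst' : s / q 0 ≤ t := by rwa [div_le_iff₀ h0, mul_comm]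
          rw [Set.indicator_of_mem (Set.mem_Iic.2 hst), ENNReal.ofReal_mul (Real.exp_pos _).le]
          congr 1
          rw [hh, ← ih (fun k => hE (k + 1)) hind.shift (fun k => hlaw (k + 1))
            (fun k => hq (k + 1)) (sub_nonneg.2 hst')]
          congr 1
          ext ω
          simp only [hD, hS, Set.mem_preimage, Set.mem_ofPred_eq, hes]
          have hTe : T = ENNReal.ofReal (s / q 0) + ENNReal.ofReal (t - s / q 0) := by
            rw [← ENNReal.ofReal_add (by positivity) (sub_nonneg.2 hst'), add_sub_cancel]
          rw [hTe, ENNReal.add_le_add_iff_left ENNReal.ofReal_ne_top,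
            ENNReal.add_lt_add_iff_left ENNReal.ofReal_ne_top]
        · rw [hempty, Set.indicator_of_notMem (by simpa using hst)]
          · simp
          · rw [hes, hT, ENNReal.ofReal_lt_ofReal_iff (by positivity), lt_div_iff₀ h0, mul_comm]
            exact not_le.1 hst
    rw [setLIntegral_congr_fun measurableSet_Ioi hint, setLIntegral_indicator measurableSet_Iic,
      Set.inter_comm, Set.Ioi_inter_Iic]
    have hnn : 0 ≤ q 0 * t := mul_nonneg (hq 0) ht
    have hcont2 : Continuous fun s => Real.exp (-s) * h (t - s / q 0) := by fun_prop
    rw [← ofReal_integral_eq_lintegral_ofReal, ← intervalIntegral.integral_of_le hnn,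
      integral_first_jump, holdProb]
    · exact (hcont2.intervalIntegrable 0 (q 0 * t)).1
    · refine (ae_restrict_iff' measurableSet_Ioc).2 (Filter.Eventually.of_forall fun s hs => ?_)
      refine mul_nonneg (Real.exp_pos _).le (holdProb_nonneg n (fun k => hq (k + 1)) ?_)
      rcases (hq 0).eq_or_lt with h0 | h0
      · rw [← h0]; simpa using ht
      · rw [sub_nonneg, div_le_iff₀ h0, mul_comm]; exact hs.2

/-! ### Paths and their probabilities -/

/-- The sequence starting at `x` and continuing through the list (then staying at its last
vertex). -/
def pathSeq {V : Type u} : V → List V → ℕ → V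
  | x, _, 0 => x
  | x, [], _ + 1 => x
  | _, z :: l, k + 1 => pathSeq z l k

theorem pathSeq_map_range {V : Type u} (p : ℕ → V) (n : ℕ) :
    ∀ k ≤ n, pathSeq (p 0) ((List.range n).map fun k => p (k + 1)) k = p k := by
  induction n generalizing p with
  | zero => intro k hk; obtain rfl : k = 0 := by omega
            rfl
  | succ n ih =>
    intro k hk
    rw [List.range_succ_eq_map, List.map_cons, List.map_map]
    rcases k with _ | k
    · rfl
    · exact ih (fun k => p (k + 1)) k (by omega)

theorem eq_of_pathSeq_eq {V : Type u} {x : V} {l l' : List V} (hlen : l.length = l'.length)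
    (h : ∀ k ≤ l.length, pathSeq x l k = pathSeq x l' k) : l = l' := by
  induction l generalizing x l' with
  | nil => exact (List.eq_nil_of_length_eq_zero hlen.symm).symm
  | cons z l ih =>
    rcases l' with _ | ⟨z', l'⟩
    · simp at hlen
    · have hz : z = z' := by
        have h1 := h 1 (by simp)
        cases l <;> cases l' <;> exact h1
      subst hz
      rw [ih (x := z) (by simpa using hlen) fun k hk => h (k + 1) (by simpa using hk)]

namespace WeightedGraph

variable {V : Type u} (Γ : WeightedGraph V)

theorem jumpProb_nonneg (x y : V) : 0 ≤ Γ.jumpProb x y := by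
  unfold jumpProb
  split_ifs
  · exact zero_le_one
  · exact le_rfl
  · exact div_nonneg (Γ.μ_nonneg _ _) (Γ.totalWeight_nonneg _)

/-- At μ_x = 0 the conventional self-jump of the chain is cancelled by the zero rate. -/
theorem jumpProb_mul_rate (x y : V) : Γ.jumpProb x y * Γ.rate x = Γ.μ x y / Γ.ν x := by
  unfold jumpProb rate
  split_ifs with h
  · simp [h, Γ.μ_eq_zero_of_totalWeight_eq_zero h]
  · simp [h, Γ.μ_eq_zero_of_totalWeight_eq_zero h]
  · have := (Γ.ν_pos x).ne'
    field_simp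

/-- The vertex set of a connected locally finite graph is countable. -/
theorem countable (Γ : WeightedGraph V) : Countable V := by
  obtain ⟨x⟩ := Γ.connected.nonempty
  let S : ℕ → Set V := fun n =>
    Nat.rec {x} (fun _ T => T ∪ ⋃ y ∈ T, {z | 0 < Γ.μ y z}) n
  have hS : ∀ n, (S n).Countable := by
    intro n
    induction n with
    | zero => exact Set.countable_singleton x
    | succ n ih => exact ih.union (ih.biUnion fun y _ => (Γ.locally_finite y).countable)
  have hcl : ∀ y z, (∃ n, y ∈ S n) → (SimpleGraph.fromRel fun x y => 0 < Γ.μ x y).Adj y z →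
      ∃ n, z ∈ S n := by
    rintro y z ⟨n, hn⟩ hadj
    refine ⟨n + 1, Or.inr ?_⟩
    rw [SimpleGraph.fromRel_adj] at hadj
    have : 0 < Γ.μ y z := hadj.2.elim id fun h => by rwa [Γ.μ_symm]
    exact Set.mem_biUnion hn this
  have hall : ∀ z, ∃ n, z ∈ S n := by
    intro z
    obtain ⟨w⟩ := Γ.connected.preconnected x z
    have : ∀ a b, (SimpleGraph.fromRel fun x y => 0 < Γ.μ x y).Walk a b → (∃ n, a ∈ S n) →
        ∃ n, b ∈ S n := by
      intro a b w
      induction w with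
      | nil => exact id
      | cons h _ ih => exact fun ha => ih (hcl _ _ ha h)
    exact this x z w ⟨0, rfl⟩
  have hU : (Set.univ : Set V) = ⋃ n, S n := by
    ext z; simpa using hall z
  rw [← Set.countable_univ_iff, hU]
  exact Set.countable_iUnion hS

/-- The probability that the walk started at `x` has followed exactly the path `x, l` by
time `t`. -/
noncomputable def pathProb (x : V) (l : List V) (t : ℝ) : ℝ :=
  (∏ k ∈ Finset.range l.length, Γ.jumpProb (pathSeq x l k) (pathSeq x l (k + 1))) *
    holdProb l.length (fun k => Γ.rate (pathSeq x l k)) t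

theorem pathProb_nonneg (x : V) (l : List V) {t : ℝ} (ht : 0 ≤ t) : 0 ≤ Γ.pathProb x l t :=
  mul_nonneg (Finset.prod_nonneg fun _ _ => Γ.jumpProb_nonneg _ _)
    (holdProb_nonneg _ (fun _ => Γ.rate_nonneg _) ht)

theorem continuous_pathProb (x : V) (l : List V) : Continuous (Γ.pathProb x l) :=
  (continuous_holdProb _ _).const_mul _

theorem pathProb_nil (x : V) (t : ℝ) : Γ.pathProb x [] t = Real.exp (-(Γ.rate x * t)) := by
  simp [pathProb, holdProb, pathSeq]

/-- First-jump decomposition; chain probability and clock rate appear only through their product,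
the generator's coefficient. -/
theorem pathProb_cons (x z : V) (l : List V) (t : ℝ) :
    Γ.pathProb x (z :: l) t = Real.exp (-(Γ.rate x * t)) *
      ∫ r in (0 : ℝ)..t, Real.exp (Γ.rate x * r) * (Γ.μ x z / Γ.ν x * Γ.pathProb z l r) := by
  have h0 : pathSeq z l 0 = z := by cases l <;> rfl
  have h1 : ∀ r, Real.exp (Γ.rate x * r) * (Γ.μ x z / Γ.ν x * Γ.pathProb z l r) =
      (Γ.jumpProb x z * Γ.rate x *
        ∏ k ∈ Finset.range l.length, Γ.jumpProb (pathSeq z l k) (pathSeq z l (k + 1))) *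
      (Real.exp (Γ.rate x * r) * holdProb l.length (fun k => Γ.rate (pathSeq z l k)) r) := by
    intro r
    rw [jumpProb_mul_rate, pathProb]; ring
  simp_rw [h1]
  rw [intervalIntegral.integral_const_mul, pathProb, List.length_cons, Finset.prod_range_succ',
    holdProb]
  simp only [pathSeq, h0]
  ring

end WeightedGraph

/-! ### The transition function as a sum over paths -/

namespace RandomWalk

variable {V : Type u} [MeasurableSpace V] {Γ : WeightedGraph V} {Ω : Type v} [MeasurableSpace Ω]
  (W : RandomWalk Γ Ω)

theorem jumpTime_mono (ω : Ω) : Monotone fun n => W.jumpTime n ω :=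
  fun _ _ h => Finset.sum_le_sum_of_subset (Finset.range_subset_range.2 h)

theorem X_eq_some_iff (t : ℝ) (ω : Ω) (y : V) :
    W.X t ω = some y ↔ ∃ n, W.jumpTime n ω ≤ ENNReal.ofReal t ∧
      ENNReal.ofReal t < W.jumpTime (n + 1) ω ∧ W.Y n ω = y := by
  have huniq : ∀ n m, W.jumpTime n ω ≤ ENNReal.ofReal t →
      ENNReal.ofReal t < W.jumpTime (m + 1) ω → n ≤ m := by
    intro n m h1 h2
    by_contra! hlt
    exact absurd (h2.trans_le (W.jumpTime_mono ω hlt)) h1.not_gt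
  unfold X
  constructor
  · intro h
    split_ifs at h with hex
    exact ⟨hex.choose, hex.choose_spec.1, hex.choose_spec.2, Option.some_injective _ h⟩
  · rintro ⟨n, h1, h2, h3⟩
    have hex : ∃ n, W.jumpTime n ω ≤ ENNReal.ofReal t ∧ ENNReal.ofReal t < W.jumpTime (n + 1) ω :=
      ⟨n, h1, h2⟩
    rw [dif_pos hex, ← h3]
    have := hex.choose_spec
    rw [le_antisymm (huniq _ _ this.1 h2) (huniq _ _ h1 this.2)]

variable [DiscreteMeasurableSpace V]

theorem measurable_jumpTime (n : ℕ) : Measurable (W.jumpTime n) := by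
  unfold jumpTime
  refine Finset.measurable_fun_sum _ fun k _ => ((W.measurable_E k).ennreal_ofReal).div ?_
  exact ((Measurable.of_discrete (f := Γ.rate)).comp (W.measurable_Y k)).ennreal_ofReal

/-- The event that the path followed up to time `t` is `x, l`. -/
def pathEvent (x : V) (l : List V) (t : ℝ) : Set Ω :=
  {ω | (∀ k ≤ l.length, W.Y k ω = pathSeq x l k) ∧
    W.jumpTime l.length ω ≤ ENNReal.ofReal t ∧ ENNReal.ofReal t < W.jumpTime (l.length + 1) ω}

theorem measurableSet_pathEvent (x : V) (l : List V) (t : ℝ) :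
    MeasurableSet (W.pathEvent x l t) := by
  refine MeasurableSet.inter (s₁ := {ω | ∀ k ≤ l.length, W.Y k ω = pathSeq x l k})
    (s₂ := {ω | W.jumpTime l.length ω ≤ ENNReal.ofReal t ∧
      ENNReal.ofReal t < W.jumpTime (l.length + 1) ω}) ?_ ?_
  · simp only [Set.ofPred_forall]
    refine MeasurableSet.iInter fun k => MeasurableSet.iInter fun _ => ?_
    exact W.measurable_Y k (MeasurableSet.singleton _)
  · exact (measurableSet_le (W.measurable_jumpTime _) measurable_const).inter
      (measurableSet_lt measurable_const (W.measurable_jumpTime _))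

/-- Once the path is fixed the rates are deterministic, so the event factors into one for the chain
and one for the independent clocks. -/
theorem measure_pathEvent (x : V) (l : List V) {t : ℝ} (ht : 0 ≤ t) :
    W.P x (W.pathEvent x l t) = ENNReal.ofReal (Γ.pathProb x l t) := by
  have := W.isProbabilityMeasure x
  set n := l.length with hn
  set p := pathSeq x l with hp
  set A : Set (ℕ → V) := {y | ∀ k ≤ n, y k = p k} with hA
  set C : Set (ℕ → ℝ) := {e |
    ∑ k ∈ Finset.range n, ENNReal.ofReal (e k) / ENNReal.ofReal (Γ.rate (p k)) ≤
      ENNReal.ofReal t ∧ ENNReal.ofReal t <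
    ∑ k ∈ Finset.range (n + 1), ENNReal.ofReal (e k) / ENNReal.ofReal (Γ.rate (p k))} with hC
  have hAm : MeasurableSet A := by
    simp only [hA, Set.ofPred_forall]
    refine MeasurableSet.iInter fun k => MeasurableSet.iInter fun _ => ?_
    exact measurable_pi_apply k (MeasurableSet.singleton _)
  have hCm : MeasurableSet C := by
    have hm : ∀ m, Measurable fun e : ℕ → ℝ =>
        ∑ k ∈ Finset.range m, ENNReal.ofReal (e k) / ENNReal.ofReal (Γ.rate (p k)) := by
      intro m; fun_prop
    exact (measurableSet_le (hm n) measurable_const).inter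
      (measurableSet_lt measurable_const (hm (n + 1)))
  have hev : W.pathEvent x l t =
      (fun ω k => W.Y k ω) ⁻¹' A ∩ (fun ω k => W.E k ω) ⁻¹' C := by
    ext ω
    refine and_congr_right fun hY => ?_
    have : ∀ m ≤ n + 1, W.jumpTime m ω = ∑ k ∈ Finset.range m,
        ENNReal.ofReal (W.E k ω) / ENNReal.ofReal (Γ.rate (p k)) := by
      intro m hm
      refine Finset.sum_congr rfl fun k hk => ?_
      rw [hY k (by have := Finset.mem_range.1 hk; omega)]
    rw [this n (by omega), this (n + 1) le_rfl]
    rfl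
  rw [hev, (W.indep_Y_E x).measure_inter_preimage_eq_mul _ _ hAm hCm]
  have h1 : W.P x ((fun ω k => W.Y k ω) ⁻¹' A) =
      ENNReal.ofReal (∏ k ∈ Finset.range n, Γ.jumpProb (p k) (p (k + 1))) :=
    W.law_Y x n p (by rw [hp]; cases l <;> rfl)
  have h2 : W.P x ((fun ω k => W.E k ω) ⁻¹' C) =
      ENNReal.ofReal (holdProb n (fun k => Γ.rate (p k)) t) :=
    measure_sum_exponential n W.measurable_E (W.indep_E x) (W.law_E x)
      (fun k => Γ.rate_nonneg _) ht
  rw [h1, h2, ← ENNReal.ofReal_mul (Finset.prod_nonneg fun _ _ => Γ.jumpProb_nonneg _ _)]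
  rfl

-- The path up to time `t` is a finite list, so these events partition the event up to the null set
-- where Y 0 ≠ x. Countability of `V` makes the union countable.
open Classical in
theorem measure_X_eq (x y : V) {t : ℝ} (ht : 0 ≤ t) :
    W.P x {ω | W.X t ω = some y} =
      ∑' l : List V, ENNReal.ofReal (if pathSeq x l l.length = y then Γ.pathProb x l t else 0) := by
  have := W.isProbabilityMeasure x
  have := Γ.countable
  set D : List V → Set Ω := fun l =>
    if pathSeq x l l.length = y then W.pathEvent x l t else ∅ with hD
  have hmem : ∀ l ω, ω ∈ D l ↔ pathSeq x l l.length = y ∧ ω ∈ W.pathEvent x l t := by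
    intro l ω
    simp only [hD]
    split_ifs with h <;> simp [h]
  have hY0 : ∀ᵐ ω ∂W.P x, W.Y 0 ω = x := by
    have h1 := W.law_Y x 0 (fun _ => x) rfl
    have h2 : {ω | ∀ k ≤ 0, W.Y k ω = x} = {ω | W.Y 0 ω = x} := by
      ext ω; simp
    rw [h2] at h1
    rw [ae_iff_measure_eq]
    · simpa using h1
    · exact (W.measurable_Y 0 (MeasurableSet.singleton x)).nullMeasurableSet
  have hae : {ω | W.X t ω = some y} =ᵐ[W.P x] ⋃ l, D l := by
    filter_upwards [hY0] with ω hω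
    refine propext ?_
    change W.X t ω = some y ↔ ω ∈ ⋃ l, D l
    rw [X_eq_some_iff, Set.mem_iUnion]
    constructor
    · rintro ⟨n, h1, h2, h3⟩
      have hpath := pathSeq_map_range (fun k => W.Y k ω) n
      rw [hω] at hpath
      refine ⟨(List.range n).map fun k => W.Y (k + 1) ω, (hmem _ _).2 ?_⟩
      have hlen : ((List.range n).map fun k => W.Y (k + 1) ω).length = n := by simp
      rw [pathEvent, hlen]
      exact ⟨(hpath n le_rfl).trans h3, fun k hk => (hpath k hk).symm, h1, h2⟩
    · rintro ⟨l, hl⟩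
      obtain ⟨h1, h2, h3, h4⟩ := (hmem _ _).1 hl
      exact ⟨l.length, h3, h4, (h2 _ le_rfl).trans h1⟩
  have hdisj : Pairwise (Function.onFun Disjoint D) := by
    intro l l' hne
    refine Set.disjoint_left.2 fun ω h h' => hne ?_
    obtain ⟨_, h2, h3, h4⟩ := (hmem _ _).1 h
    obtain ⟨_, h2', h3', h4'⟩ := (hmem _ _).1 h'
    have hle : ∀ n m, W.jumpTime n ω ≤ ENNReal.ofReal t →
        ENNReal.ofReal t < W.jumpTime (m + 1) ω → n ≤ m := by
      intro n m h1 h2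
      by_contra! hlt
      exact absurd (h2.trans_le (W.jumpTime_mono ω hlt)) h1.not_gt
    have hlen := le_antisymm (hle _ _ h3 h4') (hle _ _ h3' h4)
    exact eq_of_pathSeq_eq hlen fun k hk => (h2 k hk).symm.trans (h2' k (hlen ▸ hk))
  have hDm : ∀ l, MeasurableSet (D l) := by
    intro l
    simp only [hD]
    split_ifs
    · exact W.measurableSet_pathEvent x l t
    · exact MeasurableSet.empty
  rw [measure_congr hae, measure_iUnion hdisj hDm]
  refine tsum_congr fun l => ?_
  simp only [hD]
  split_ifs
  · exact W.measure_pathEvent x l ht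
  · simp

end RandomWalk

/-! ### Path expansion of the killed semigroup -/

namespace WeightedGraph

variable {V : Type u} (Γ : WeightedGraph V)

open Classical in
/-- The lists of length `n` with entries in `B`. -/
noncomputable def pathLists (B : Finset V) : ℕ → Finset (List V)
  | 0 => {[]}
  | n + 1 => (B ×ˢ pathLists B n).image fun p => p.1 :: p.2

theorem mem_pathLists (B : Finset V) (n : ℕ) (l : List V) :
    l ∈ pathLists B n ↔ l.length = n ∧ ∀ z ∈ l, z ∈ B := by
  induction n generalizing l with
  | zero =>
    simp only [pathLists, Finset.mem_singleton, List.length_eq_zero_iff]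
    constructor
    · rintro rfl; simp
    · exact fun h => h.1
  | succ n ih =>
    simp only [pathLists, Finset.mem_image, Finset.mem_product, Prod.exists]
    constructor
    · rintro ⟨z, l', ⟨hz, hl'⟩, rfl⟩
      have := (ih l').1 hl'
      simp [this.1, hz]
      exact this.2
    · rintro ⟨h1, h2⟩
      rcases l with _ | ⟨z, l'⟩
      · simp at h1
      · exact ⟨z, l', ⟨h2 z (by simp), (ih l').2 ⟨by simpa using h1, fun w hw => h2 w (by simp [hw])⟩⟩,
          rfl⟩

open Classical in
/-- The probability of having followed `x, l` by time `t` if this path ends at `y`, and `0`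
otherwise. -/
noncomputable def pathProbTo (y x : V) (l : List V) (t : ℝ) : ℝ :=
  if pathSeq x l l.length = y then Γ.pathProb x l t else 0

theorem pathProbTo_nonneg (y x : V) (l : List V) {t : ℝ} (ht : 0 ≤ t) :
    0 ≤ Γ.pathProbTo y x l t := by
  unfold pathProbTo
  split_ifs
  · exact Γ.pathProb_nonneg x l ht
  · exact le_rfl

theorem continuous_pathProbTo (y x : V) (l : List V) : Continuous (Γ.pathProbTo y x l) := by
  unfold pathProbTo
  split_ifs
  · exact Γ.continuous_pathProb x l
  · exact continuous_const

theorem pathProbTo_cons (y x z : V) (l : List V) (t : ℝ) :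
    Γ.pathProbTo y x (z :: l) t = Real.exp (-(Γ.rate x * t)) *
      ∫ r in (0 : ℝ)..t, Real.exp (Γ.rate x * r) * (Γ.μ x z / Γ.ν x * Γ.pathProbTo y z l r) := by
  simp only [pathProbTo]
  have : pathSeq x (z :: l) (z :: l).length = pathSeq z l l.length := rfl
  rw [this]
  split_ifs
  · exact Γ.pathProb_cons x z l t
  · simp

/-- The probability that the walk started at `x` is at `y` at time `t` after exactly `n` jumps, all
within `B`. -/
noncomputable def jumpKernel (B : Finset V) (y : V) (n : ℕ) (x : V) (t : ℝ) : ℝ :=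
  ∑ l ∈ pathLists B n, Γ.pathProbTo y x l t

theorem continuous_jumpKernel (B : Finset V) (y : V) (n : ℕ) (x : V) :
    Continuous (Γ.jumpKernel B y n x) :=
  continuous_finsetSum _ fun l _ => Γ.continuous_pathProbTo y x l

open Classical in
theorem jumpKernel_zero (B : Finset V) (x y : V) (t : ℝ) :
    Γ.jumpKernel B y 0 x t = if x = y then Real.exp (-(Γ.rate x * t)) else 0 := by
  simp [jumpKernel, pathLists, pathProbTo, pathSeq, pathProb_nil]

theorem jumpKernel_succ (B : Finset V) (y : V) (n : ℕ) (x : V) (t : ℝ) :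
    Γ.jumpKernel B y (n + 1) x t = Real.exp (-(Γ.rate x * t)) *
      ∫ r in (0 : ℝ)..t, Real.exp (Γ.rate x * r) *
        ∑ z : B, Γ.μ x z / Γ.ν x * Γ.jumpKernel B y n z r := by
  classical
  have hinj : Function.Injective fun p : V × List V => p.1 :: p.2 := by
    rintro ⟨a, b⟩ ⟨c, d⟩ h
    simpa using h
  have hint : ∀ z l, IntervalIntegrable (fun r => Real.exp (Γ.rate x * r) *
      (Γ.μ x z / Γ.ν x * Γ.pathProbTo y z l r)) volume 0 t := by
    intro z l
    have := Γ.continuous_pathProbTo y z l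
    exact Continuous.intervalIntegrable (by fun_prop) _ _
  have h1 : ∀ r, Real.exp (Γ.rate x * r) * ∑ z : B, Γ.μ x z / Γ.ν x * Γ.jumpKernel B y n z r =
      ∑ p ∈ B ×ˢ pathLists B n, Real.exp (Γ.rate x * r) *
        (Γ.μ x p.1 / Γ.ν x * Γ.pathProbTo y p.1 p.2 r) := by
    intro r
    rw [Finset.sum_product, Finset.mul_sum,
      Finset.sum_coe_sort B fun z => Real.exp (Γ.rate x * r) *
        (Γ.μ x z / Γ.ν x * Γ.jumpKernel B y n z r)]
    refine Finset.sum_congr rfl fun z _ => ?_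
    rw [jumpKernel, Finset.mul_sum, Finset.mul_sum]
  simp_rw [h1]
  rw [intervalIntegral.integral_finsetSum fun p _ => hint p.1 p.2, Finset.mul_sum, jumpKernel,
    pathLists, Finset.sum_image hinj.injOn]
  exact Finset.sum_congr rfl fun p _ => Γ.pathProbTo_cons y x p.1 p.2 t

/-- The transition function of the walk killed outside `B`. -/
noncomputable def killedTransition (B : Finset V) (y x : B) (t : ℝ) : ℝ :=
  √(Γ.ν y / Γ.ν x) * Γ.killedKernel B t x y

theorem hasDerivAt_killedTransition (B : Finset V) (y x : B) (t : ℝ) :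
    HasDerivAt (Γ.killedTransition B y x)
      (∑ z : B, Γ.μ x z / Γ.ν x * Γ.killedTransition B y z t -
        Γ.rate x * Γ.killedTransition B y x t) t := by
  classical
  refine ((Γ.hasDerivAt_killedKernel B t x y).const_mul (√(Γ.ν y / Γ.ν x))).congr_deriv ?_
  have h1 : ∑ z, Γ.symmGenerator B x z * Γ.killedKernel B t z y =
      ∑ z : B, Γ.μ x z / (√(Γ.ν x) * √(Γ.ν z)) * Γ.killedKernel B t z y -
        Γ.rate x * Γ.killedKernel B t x y := by
    simp [symmGenerator, sub_mul, Finset.sum_sub_distrib, ite_mul]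
  rw [h1, mul_sub, Finset.mul_sum]
  congr 1
  · refine Finset.sum_congr rfl fun z _ => ?_
    have hx := Real.sqrt_pos.2 (Γ.ν_pos x)
    have hz := Real.sqrt_pos.2 (Γ.ν_pos z)
    rw [killedTransition, Real.sqrt_div (Γ.ν_pos y).le, Real.sqrt_div (Γ.ν_pos y).le]
    conv_rhs => rw [← Real.mul_self_sqrt (Γ.ν_pos x).le]
    field_simp
  · unfold killedTransition; ring

theorem continuous_killedTransition (B : Finset V) (y x : B) :
    Continuous (Γ.killedTransition B y x) :=
  continuous_iff_continuousAt.2 fun t => (Γ.hasDerivAt_killedTransition B y x t).continuousAt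

/-- Variation of constants in the backward equation, with integrating factor exp(rate · t). It is
the equation obtained by summing `jumpKernel_succ` over n, so the remainder of the path expansion
can be iterated. -/
theorem killedTransition_eq (B : Finset V) (y x : B) (t : ℝ) :
    Γ.killedTransition B y x t = Γ.jumpKernel B y 0 x t + Real.exp (-(Γ.rate x * t)) *
      ∫ r in (0 : ℝ)..t, Real.exp (Γ.rate x * r) *
        ∑ z : B, Γ.μ x z / Γ.ν x * Γ.killedTransition B y z r := by
  classical
  have hcont := fun z => Γ.continuous_killedTransition B y z
  have hder : ∀ r, HasDerivAt (fun r => Real.exp (Γ.rate x * r) * Γ.killedTransition B y x r)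
      (Real.exp (Γ.rate x * r) * ∑ z : B, Γ.μ x z / Γ.ν x * Γ.killedTransition B y z r) r := by
    intro r
    have h1 : HasDerivAt (fun r => Real.exp (Γ.rate x * r))
        (Real.exp (Γ.rate x * r) * Γ.rate x) r := by
      simpa using ((hasDerivAt_id r).const_mul (Γ.rate x)).exp
    refine (h1.mul (Γ.hasDerivAt_killedTransition B y x r)).congr_deriv ?_
    ring
  rw [intervalIntegral.integral_eq_sub_of_hasDerivAt (fun r _ => hder r)
    (Continuous.intervalIntegrable (by fun_prop) _ _), jumpKernel_zero]
  have h0 : Γ.killedTransition B y x 0 = if (x : V) = y then 1 else 0 := by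
    rw [killedTransition, killedKernel_zero, Matrix.one_apply]
    by_cases hxy : x = y
    · subst hxy
      simp [div_self (Γ.ν_pos x).ne']
    · have : (x : V) ≠ y := fun h => hxy (Subtype.ext h)
      simp [hxy]
  have he : Real.exp (-(Γ.rate x * t)) * Real.exp (Γ.rate x * t) = 1 := by
    rw [← Real.exp_add]; simp
  rw [h0, mul_sub, ← mul_assoc, he]
  split_ifs <;> simp

open Finset in
theorem killedTransition_sub_sum_eq (B : Finset V) (y x : B) (N : ℕ) (t : ℝ) :
    Γ.killedTransition B y x t - ∑ n ∈ range (N + 1), Γ.jumpKernel B y n x t =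
      Real.exp (-(Γ.rate x * t)) * ∫ r in (0 : ℝ)..t, Real.exp (Γ.rate x * r) *
        ∑ z : B, Γ.μ x z / Γ.ν x *
          (Γ.killedTransition B y z r - ∑ n ∈ range N, Γ.jumpKernel B y n z r) := by
  have hc1 := fun z => Γ.continuous_killedTransition B y z
  have hc2 := fun n z => Γ.continuous_jumpKernel B y n z
  have e : ∀ r, Real.exp (Γ.rate x * r) * ∑ z : B, Γ.μ x z / Γ.ν x *
      (Γ.killedTransition B y z r - ∑ n ∈ range N, Γ.jumpKernel B y n z r) =
      Real.exp (Γ.rate x * r) * (∑ z : B, Γ.μ x z / Γ.ν x * Γ.killedTransition B y z r) -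
      ∑ n ∈ range N, Real.exp (Γ.rate x * r) *
        ∑ z : B, Γ.μ x z / Γ.ν x * Γ.jumpKernel B y n z r := by
    intro r
    rw [← Finset.mul_sum, ← mul_sub, Finset.sum_comm, ← Finset.sum_sub_distrib]
    congr 1
    refine Finset.sum_congr rfl fun z _ => ?_
    rw [mul_sub, Finset.mul_sum]
  simp_rw [e]
  rw [intervalIntegral.integral_sub (Continuous.intervalIntegrable (by fun_prop) _ _)
    (Continuous.intervalIntegrable (by fun_prop) _ _),
    intervalIntegral.integral_finsetSum
      fun n _ => (Continuous.intervalIntegrable (by fun_prop) _ _),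
    mul_sub, Finset.mul_sum, sum_range_succ', Γ.killedTransition_eq B y x t]
  simp_rw [← jumpKernel_succ]
  ring

-- Each iteration integrates q exp(-q(s - r)) over [0, s], gaining 1 - exp(-qs) ≤ 1 - exp(-QT) < 1.
open Finset in
theorem abs_killedTransition_sub_sum_le (B : Finset V) (y : B) {T Q M : ℝ}
    (hQ : ∀ x : B, Γ.rate x ≤ Q)
    (hM : ∀ s ∈ Set.Icc 0 T, ∀ x, |Γ.killedTransition B y x s| ≤ M) (N : ℕ) :
    ∀ s ∈ Set.Icc 0 T, ∀ x : B,
      |Γ.killedTransition B y x s - ∑ n ∈ range N, Γ.jumpKernel B y n x s| ≤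
        M * (1 - Real.exp (-(Q * T))) ^ N := by
  induction N with
  | zero => simpa using hM
  | succ N ih =>
    intro s hs x
    set κ := 1 - Real.exp (-(Q * T)) with hκ
    have hQ0 : 0 ≤ Q := (Γ.rate_nonneg x).trans (hQ x)
    have hT : 0 ≤ T := hs.1.trans hs.2
    have hM0 : 0 ≤ M := (abs_nonneg _).trans (hM s hs x)
    have hκ0 : 0 ≤ κ := by
      rw [hκ, sub_nonneg, Real.exp_le_one_iff, neg_nonpos]; positivity
    set q := Γ.rate x with hq
    have hsum : ∑ z : B, Γ.μ x z / Γ.ν x ≤ q := by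
      rw [← Finset.sum_div, hq, rate]
      have := Γ.sum_μ_le_totalWeight x B
      rw [← Finset.sum_coe_sort] at this
      exact div_le_div_of_nonneg_right this (Γ.ν_pos x).le
    have hbound : ∀ r ∈ Set.Ioc 0 s, ‖Real.exp (q * r) * ∑ z : B, Γ.μ x z / Γ.ν x *
        (Γ.killedTransition B y z r - ∑ n ∈ range N, Γ.jumpKernel B y n z r)‖ ≤
        M * κ ^ N * (q * Real.exp (q * r)) := by
      intro r hr
      rw [Real.norm_eq_abs, abs_mul, abs_of_pos (Real.exp_pos _)]
      have h1 : |∑ z : B, Γ.μ x z / Γ.ν x *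
          (Γ.killedTransition B y z r - ∑ n ∈ range N, Γ.jumpKernel B y n z r)| ≤
          ∑ z : B, Γ.μ x z / Γ.ν x * (M * κ ^ N) := by
        refine (Finset.abs_sum_le_sum_abs _ _).trans (Finset.sum_le_sum fun z _ => ?_)
        have h2 : 0 ≤ Γ.μ x z / Γ.ν x := div_nonneg (Γ.μ_nonneg _ _) (Γ.ν_pos _).le
        rw [abs_mul, abs_of_nonneg h2]
        exact mul_le_mul_of_nonneg_left (ih r ⟨hr.1.le, hr.2.trans hs.2⟩ z) h2
      rw [← Finset.sum_mul] at h1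
      calc _ ≤ Real.exp (q * r) * (q * (M * κ ^ N)) := by
            refine mul_le_mul_of_nonneg_left (h1.trans ?_) (Real.exp_pos _).le
            exact mul_le_mul_of_nonneg_right hsum (by positivity)
        _ = _ := by ring
    have hder : ∀ r, HasDerivAt (fun r => M * κ ^ N * Real.exp (q * r))
        (M * κ ^ N * (q * Real.exp (q * r))) r := by
      intro r
      have h1 := ((hasDerivAt_id r).const_mul q).exp.const_mul (M * κ ^ N)
      refine h1.congr_deriv ?_
      simp only [id_eq, mul_one]
      ring
    have hint : IntervalIntegrable (fun r => M * κ ^ N * (q * Real.exp (q * r))) volume 0 s :=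
      Continuous.intervalIntegrable (by fun_prop) _ _
    have hI := intervalIntegral.norm_integral_le_of_norm_le hs.1
      (Filter.Eventually.of_forall hbound) hint
    rw [intervalIntegral.integral_eq_sub_of_hasDerivAt (fun r _ => hder r) hint] at hI
    rw [killedTransition_sub_sum_eq, abs_mul, abs_of_pos (Real.exp_pos _)]
    rw [Real.norm_eq_abs] at hI
    have he : Real.exp (-(q * s)) * Real.exp (q * s) = 1 := by
      rw [← Real.exp_add]; simp
    calc _ ≤ Real.exp (-(q * s)) *
          (M * κ ^ N * Real.exp (q * s) - M * κ ^ N * Real.exp (q * 0)) :=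
          mul_le_mul_of_nonneg_left hI (Real.exp_pos _).le
      _ = M * κ ^ N * (Real.exp (-(q * s)) * Real.exp (q * s) - Real.exp (-(q * s))) := by
          rw [mul_zero, Real.exp_zero]; ring
      _ ≤ M * κ ^ N * κ := by
          rw [he, hκ]
          refine mul_le_mul_of_nonneg_left (sub_le_sub_left (Real.exp_le_exp.2 ?_) _) (by positivity)
          rw [neg_le_neg_iff]
          exact mul_le_mul (hQ x) hs.2 hs.1 hQ0
      _ = _ := by rw [pow_succ]; ring

/-- The killed transition function is the sum over the number of jumps. -/
theorem tendsto_sum_jumpKernel (B : Finset V) (x y : B) {t : ℝ} (ht : 0 ≤ t) :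
    Filter.Tendsto (fun N => ∑ n ∈ Finset.range N, Γ.jumpKernel B y n x t) Filter.atTop
      (nhds (Γ.killedTransition B y x t)) := by
  set Q := ∑ z : B, Γ.rate z with hQ
  have hQx : ∀ x : B, Γ.rate x ≤ Q := fun x =>
    Finset.single_le_sum (f := fun z : B => Γ.rate z) (fun z _ => Γ.rate_nonneg z)
      (Finset.mem_univ x)
  obtain ⟨M, hM⟩ : ∃ M, ∀ s ∈ Set.Icc 0 t, ∀ x, |Γ.killedTransition B y x s| ≤ M := by
    have hc : Continuous fun s => fun x => Γ.killedTransition B y x s :=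
      continuous_pi fun x => Γ.continuous_killedTransition B y x
    obtain ⟨M, hM⟩ := isCompact_Icc.exists_bound_of_continuousOn (s := Set.Icc 0 t) hc.continuousOn
    exact ⟨M, fun s hs x => (norm_le_pi_norm (fun x => Γ.killedTransition B y x s) x).trans
      (hM s hs)⟩
  have hQ0 : 0 ≤ Q := (Γ.rate_nonneg x).trans (hQx x)
  have hlim : Filter.Tendsto (fun N => M * (1 - Real.exp (-(Q * t))) ^ N) Filter.atTop (nhds 0) := by
    have h1 : 0 ≤ 1 - Real.exp (-(Q * t)) := by
      rw [sub_nonneg, Real.exp_le_one_iff, neg_nonpos]; positivity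
    have h2 : 1 - Real.exp (-(Q * t)) < 1 := by linarith [Real.exp_pos (-(Q * t))]
    simpa using (tendsto_pow_atTop_nhds_zero_of_lt_one h1 h2).const_mul M
  rw [tendsto_iff_norm_sub_tendsto_zero]
  refine squeeze_zero (fun _ => norm_nonneg _) (fun N => ?_) hlim
  rw [Real.norm_eq_abs, abs_sub_comm]
  exact Γ.abs_killedTransition_sub_sum_le B y hQx hM N t ⟨ht, le_rfl⟩ x

open Classical in
theorem sum_jumpKernel_eq (B : Finset V) (y x : V) (N : ℕ) (t : ℝ) :
    ∑ n ∈ Finset.range N, Γ.jumpKernel B y n x t =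
      ∑ l ∈ (Finset.range N).biUnion (pathLists B), Γ.pathProbTo y x l t := by
  rw [Finset.sum_biUnion]
  · rfl
  · intro n _ m _ hnm
    refine Finset.disjoint_left.2 fun l h h' => hnm ?_
    rw [← ((mem_pathLists B n l).1 h).1, ((mem_pathLists B m l).1 h').1]

theorem sum_pathProbTo_le_killedTransition (B : Finset V) (x y : B) {t : ℝ} (ht : 0 ≤ t)
    (F : Finset (List V)) (hF : ∀ l ∈ F, ∀ z ∈ l, z ∈ B) :
    ∑ l ∈ F, Γ.pathProbTo y x l t ≤ Γ.killedTransition B y x t := by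
  classical
  refine ge_of_tendsto (Γ.tendsto_sum_jumpKernel B x y ht) ?_
  filter_upwards [Filter.eventually_gt_atTop (F.sup List.length)] with N hN
  rw [sum_jumpKernel_eq]
  refine Finset.sum_le_sum_of_subset_of_nonneg (fun l hl => ?_)
    fun l _ _ => Γ.pathProbTo_nonneg _ _ l ht
  rw [Finset.mem_biUnion]
  exact ⟨l.length, Finset.mem_range.2 ((Finset.le_sup hl).trans_lt hN),
    (mem_pathLists B _ l).2 ⟨rfl, hF l hl⟩⟩

end WeightedGraph

/-! ### Comparison with the walk and conclusion -/

namespace RandomWalk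

variable {V : Type u} [MeasurableSpace V] {Γ : WeightedGraph V} {Ω : Type v} [MeasurableSpace Ω]
  (W : RandomWalk Γ Ω) [DiscreteMeasurableSpace V]

theorem measure_X_eq_tsum (x y : V) {t : ℝ} (ht : 0 ≤ t) :
    W.P x {ω | W.X t ω = some y} = ∑' l : List V, ENNReal.ofReal (Γ.pathProbTo y x l t) :=
  W.measure_X_eq x y ht

/-- Paths inside `B` are among all paths, and every path contributes nonnegatively. -/
theorem killedTransition_le (B : Finset V) (x y : B) {t : ℝ} (ht : 0 ≤ t) :
    Γ.killedTransition B y x t ≤ (W.P x).real {ω | W.X t ω = some (y : V)} := by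
  classical
  have := W.isProbabilityMeasure x
  refine le_of_tendsto (Γ.tendsto_sum_jumpKernel B x y ht) (Filter.Eventually.of_forall fun N => ?_)
  rw [WeightedGraph.sum_jumpKernel_eq, Measure.real,
    ← ENNReal.ofReal_le_iff_le_toReal (measure_ne_top _ _), W.measure_X_eq_tsum x y ht,
    ENNReal.ofReal_sum_of_nonneg fun l _ => Γ.pathProbTo_nonneg _ _ l ht]
  exact ENNReal.sum_le_tsum _

/-- An upper bound for the killed transition functions, uniform over the finite sets containing the
two vertices, is an upper bound for the transition function of the walk. -/
theorem real_measure_X_le (x y : V) {t c : ℝ} (ht : 0 ≤ t)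
    (h : ∀ (B : Finset V) (hx : x ∈ B) (hy : y ∈ B), Γ.killedTransition B ⟨y, hy⟩ ⟨x, hx⟩ t ≤ c)
    (hc : 0 ≤ c) : (W.P x).real {ω | W.X t ω = some y} ≤ c := by
  classical
  refine ENNReal.toReal_le_of_le_ofReal hc ?_
  rw [W.measure_X_eq_tsum x y ht, ENNReal.tsum_eq_iSup_sum]
  refine iSup_le fun F => ?_
  rw [← ENNReal.ofReal_sum_of_nonneg fun l _ => Γ.pathProbTo_nonneg _ _ l ht]
  refine ENNReal.ofReal_le_ofReal ?_
  -- A finite family of paths visits finitely many vertices, so some finite set contains them all.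
  set B : Finset V := {x, y} ∪ F.biUnion List.toFinset with hB
  refine (Γ.sum_pathProbTo_le_killedTransition B ⟨x, by simp [hB]⟩ ⟨y, by simp [hB]⟩ ht F
    fun l hl z hz => ?_).trans (h B _ _)
  refine Finset.mem_union_right _ (Finset.mem_biUnion.2 ⟨l, hl, by simpa using hz⟩)

end RandomWalk

theorem theorem1p1 :
    ∃ C₁ θ : ℝ, 0 < C₁ ∧ 0 < θ ∧
      ∀ (V : Type u) [MetricSpace V] [MeasurableSpace V] [DiscreteMeasurableSpace V]
        (Γ : WeightedGraph V) (_ : Γ.IsAdapted)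
        (Ω : Type v) [MeasurableSpace Ω] (W : RandomWalk Γ Ω)
        (x₁ x₂ : V) (f₁ f₂ : ℝ → ℝ) (A γ δ : ℝ),
        1 ≤ A → 1 < γ → 1 ≤ δ →
        (∀ t, 0 < t → (W.P x₁).real {ω | W.X t ω = some x₁} ≤ 1 / f₁ t) →
        (∀ t, 0 < t → (W.P x₂).real {ω | W.X t ω = some x₂} ≤ 1 / f₂ t) →
        HasRegularGrowth A γ f₁ → HasRegularGrowth A γ f₂ →
        (∀ t, 0 < t → f₁ t ≤ A * Real.exp (δ * t)) →
        (∀ t, 0 < t → f₂ t ≤ A * Real.exp (δ * t)) →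
        ∀ (α : ℝ) (β : ℕ), α = min (2 * γ)⁻¹ (64 * δ)⁻¹ → β = ⌈Real.log 2 / Real.log γ⌉₊ →
        ∀ t : ℝ, 0 < t → dist x₁ x₂ ≤ t →
          (W.P x₁).real {ω | W.X t ω = some x₂} ≤
            C₁ * A ^ β * Real.sqrt (Γ.ν x₂ / Γ.ν x₁) / Real.sqrt (f₁ (α * t) * f₂ (α * t)) *
              Real.exp (-θ * (dist x₁ x₂ ^ 2 / t)) := by
  refine ⟨2 * Real.exp 2, 1 / 24576, by positivity, by norm_num, ?_⟩
  intro V _ _ _ Γ hΓ Ω _ W x₁ x₂ f₁ f₂ A γ δ hA hγ hδ hP₁ hP₂ hf₁ hf₂ hb₁ hb₂ α β hα hβ t ht hdt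
  obtain ⟨hβ1, hβ2, hβγ⟩ := pow_ceil_log_two_bounds hγ hβ
  have hγ0 : 0 < γ := by linarith
  have hδ0 : 0 < δ := by linarith
  have hα0 : 0 < α := by rw [hα]; positivity
  have hαγ : α ≤ 1 / γ ^ β := by
    rw [hα, one_div]
    exact (min_le_left _ _).trans (inv_anti₀ (by positivity) hβγ)
  have hαδ : δ * α ≤ 1 / 64 := by
    have : α ≤ (64 * δ)⁻¹ := hα ▸ min_le_right _ _
    calc δ * α ≤ δ * (64 * δ)⁻¹ := by gcongr
      _ = 1 / 64 := by field_simp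
  have hAβ : A ≤ A ^ β := le_self_pow₀ hA (by omega)
  have hexp : ∀ {f : ℝ → ℝ}, (∀ t, 0 < t → f t ≤ A * Real.exp (δ * t)) →
      ∀ s, 0 < s → f s ≤ A ^ β * Real.exp (δ * s) := fun h s hs =>
    (h s hs).trans (mul_le_mul_of_nonneg_right hAβ (Real.exp_pos _).le)
  -- On the diagonal the conjugation by `√ν` disappears.
  have hdiag : ∀ {f : ℝ → ℝ} (B : Finset V) (x : B),
      (∀ t, 0 < t → (W.P x).real {ω | W.X t ω = some (x : V)} ≤ 1 / f t) →
      ∀ s, 0 < s → Γ.killedKernel B s x x ≤ 1 / f s := by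
    intro f B x h s hs
    have h1 := (W.killedTransition_le B x x hs.le).trans (h s hs)
    rwa [WeightedGraph.killedTransition, div_self (Γ.ν_pos x).ne', Real.sqrt_one, one_mul] at h1
  refine W.real_measure_X_le x₁ x₂ ht.le (fun B h₁ h₂ => ?_) (by positivity)
  have key := hΓ.killedKernel_le_gaussian B ⟨x₁, h₁⟩ ⟨x₂, h₂⟩ (one_le_pow₀ hA) hβ2
    (hf₁.iterate hA hγ β) (hf₂.iterate hA hγ β) (hexp hb₁) (hexp hb₂) hα0 hαγ hαδ
    (hdiag B _ hP₁) (hdiag B _ hP₂) ht hdt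
  refine (mul_le_mul_of_nonneg_left key (Real.sqrt_nonneg _)).trans (le_of_eq ?_)
  ring
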